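/- **Problem.** There are $m\ge 1$ servers, each with $C$ units of resource ($C\ge 1$ an integer), and $n\ge 1$ threads; thread $i$ has a nonnegative, nondecreasing, concave utility function $f_i:[0,C]\to\mathbb R$. A *super-optimal allocation (in whole units)* is a vector of integers $\hat c_1,\dots,\hat c_n\in[0,C]$ that maximizes $\sum_i f_i(\hat c_i)$ among all integer vectors in $[0,C]^n$ with $\sum_i \hat c_i\le mC$. Given such an allocation put $g_i(x)=f_i(\hat c_i)\,x/\hat c_i$ for $x<\hat c_i$ and $g_i(x)=f_i(\hat c_i)$ otherwise. **Algorithm 1.** Set $C_j\leftarrow C$ for all servers $j$ and $R\leftarrow\{1,\dots,n\}$. While $R\ne\emptyset$: compute $U=\{(i,j): i\in R,\ 1\le j\le m,\ \hat c_i\le C_j\}$. If $U\neq\emptyset$, choose $(i,j)\in U$ maximizing $g_i(\hat c_i)$ and set $c_i\leftarrow\hat c_i$; otherwise choose $i\in R$ and $1\le j\le m$ maximizing $g_i(C_j)$ and set $c_i\leftarrow C_j$. Then set $r_i\leftarrow j$, $R\leftarrow R\setminus\{i\}$, $C_j\leftarrow C_j-c_i$. Return $(r_1,c_1),\dots,(r_n,c_n)$.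 (Ties are broken arbitrarily.) **Model of computation.** A unit-cost random access machine with natural and real variables and arrays. One step is one read or write of a variable or array cell, one addition, truncated subtraction or halving of naturals, one addition, subtraction, multiplication or division of reals, one conversion of a natural to a real, one comparison or Boolean operation, or one evaluation $f_i(k)$ at a natural number $k$. The input is $n,m,C$ and access to the $f_i$ in this form. **Theorem.** There are a program that computes a super-optimal allocation and a constant $K$, both independent of $n,m,C$ and the $f_i$, such that for every instance the following holds. This program followed by a direct implementation of Algorithm 1 halts after at most $$K\bigl(mn^2+n(\log (mC))^2\bigr)$$ steps in total, the first part ending with a super-optimal allocation in whole units $\hat c_1,\dots,\hat c_n$ and the second with a possible output $(r_1,c_1),\dots,(r_n,c_n)$ of Algorithm 1 on it. Moreover, if every $f_i$ is affine between consecutive integers, then $\hat c$ maximizes $\sum_i f_i(\hat c_i)$ also among all real vectors in $[0,C]^n$ with $\sum_i\hat c_i\le mC$. -/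

import Mathlib

open Finset

noncomputable section

namespace AA

/-! ## The problem -/

/-- An instance of the assign-and-allocate problem with `n` threads and `m` servers: every server
has an amount `C > 0` of resource, and thread `i` has a utility function `f i` that is nonnegative,
nondecreasing and concave on `[0, C]` (its values outside of `[0, C]` are irrelevant). -/
structure Problem (n m : ℕ) where
  C : ℝ
  C_pos : 0 < C
  f : Fin n → ℝ → ℝ
  nonneg : ∀ i, ∀ x ∈ Set.Icc 0 C, 0 ≤ f i x
  mono : ∀ i, MonotoneOn (f i) (Set.Icc 0 C)
  concave : ∀ i, ConcaveOn ℝ (Set.Icc 0 C) (f i)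

namespace Problem

variable {n m : ℕ} (A : Problem n m)

/-- Allocations that use at most `m * C` resource in total (and at most `C` per thread, the
utility functions being functions on `[0, C]`). -/
def Pooled : Set (Fin n → ℝ) :=
  {c | (∀ i, c i ∈ Set.Icc 0 A.C) ∧ ∑ i, c i ≤ m * A.C}

/-- Allocations in whole units of resource. -/
def WholeUnits : Set (Fin n → ℝ) :=
  {c | ∀ i, ∃ k : ℕ, c i = k}

/-- `c` maximizes the total utility among all real allocations with total at most `m * C`. -/
def IsSuperOptimal (c : Fin n → ℝ) : Prop :=
  c ∈ A.Pooled ∧ IsMaxOn (fun c => ∑ i, A.f i (c i)) A.Pooled c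

/-- `c` is in whole units and maximizes the total utility among all allocations in whole units
with total at most `m * C`. -/
def IsUnitSuperOptimal (c : Fin n → ℝ) : Prop :=
  c ∈ A.Pooled ∩ WholeUnits ∧
    IsMaxOn (fun c => ∑ i, A.f i (c i)) (A.Pooled ∩ WholeUnits) c

/-- Every utility function is affine between consecutive whole units of resource. -/
def AffineBetweenUnits : Prop :=
  ∀ i, ∀ k : ℕ, (k : ℝ) + 1 ≤ A.C → ∀ x ∈ Set.Icc (0 : ℝ) 1,
    A.f i (k + x) = (1 - x) * A.f i k + x * A.f i (k + 1)

/-- The linearized utility functions for an allocation `chat`. -/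
def g (chat : Fin n → ℝ) (i : Fin n) (x : ℝ) : ℝ :=
  if x < chat i then A.f i (chat i) * (x / chat i) else A.f i (chat i)

/-- The unassigned threads paired with the servers that can still give them `chat i`. -/
def U (chat : Fin n → ℝ) (rem : Fin m → ℝ) (R : Finset (Fin n)) : Set (Fin n × Fin m) :=
  {p | p.1 ∈ R ∧ chat p.1 ≤ rem p.2}

/-- `Run chat rem R r c`: started with remaining resources `rem` on the servers and with the set `R`
of unassigned threads, the main loop of the assignment algorithm can, for some way of breaking
the ties, end with every thread `i ∈ R` placed on server `r i` with allocation `c i`. -/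
inductive Run (chat : Fin n → ℝ) :
    (Fin m → ℝ) → Finset (Fin n) → (Fin n → Fin m) → (Fin n → ℝ) → Prop
  | done (rem : Fin m → ℝ) (r : Fin n → Fin m) (c : Fin n → ℝ) : Run chat rem ∅ r c
  | full (rem : Fin m → ℝ) (R : Finset (Fin n)) (r : Fin n → Fin m) (c : Fin n → ℝ)
      (i : Fin n) (j : Fin m) (hU : (i, j) ∈ U chat rem R)
      (hmax : ∀ p ∈ U chat rem R, A.g chat p.1 (chat p.1) ≤ A.g chat i (chat i))
      (hc : c i = chat i) (hr : r i = j)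
      (next : Run chat (Function.update rem j (rem j - c i)) (R.erase i) r c) :
      Run chat rem R r c
  | unfull (rem : Fin m → ℝ) (R : Finset (Fin n)) (r : Fin n → Fin m) (c : Fin n → ℝ)
      (i : Fin n) (j : Fin m) (hU : U chat rem R = ∅) (hi : i ∈ R)
      (hmax : ∀ i' ∈ R, ∀ j', A.g chat i' (rem j') ≤ A.g chat i (rem j))
      (hc : c i = rem j) (hr : r i = j)
      (next : Run chat (Function.update rem j (rem j - c i)) (R.erase i) r c) :
      Run chat rem R r c

/-- `(r, c)` is a possible output of the assignment algorithm on the allocation `chat`. -/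
def IsOutput (chat : Fin n → ℝ) (r : Fin n → Fin m) (c : Fin n → ℝ) : Prop :=
  A.Run chat (fun _ => A.C) Finset.univ r c

/-- Access to the utility functions at whole numbers of units. -/
def oracle (i k : ℕ) : ℝ :=
  if h : i < n then A.f ⟨i, h⟩ k else 0

end Problem

/-! ## The machine: a unit-cost random access machine over the naturals and the reals -/

/-- The memory: natural and real variables, natural and real arrays, each named by a number. -/
@[ext] structure Store where
  nv : ℕ → ℕ
  na : ℕ → ℕ → ℕ
  rv : ℕ → ℝ
  ra : ℕ → ℕ → ℝ

/-- Natural expressions: constants, variables, array cells, sum, truncated difference, halving. -/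
inductive NExp
  | lit (k : ℕ)
  | var (x : ℕ)
  | cell (a : ℕ) (e : NExp)
  | add (e₁ e₂ : NExp)
  | sub (e₁ e₂ : NExp)
  | half (e : NExp)

/-- Real expressions: variables, array cells, values of naturals, field operations, and the value
`f i k` of a utility function. There is no conversion from reals to naturals. -/
inductive RExp
  | var (x : ℕ)
  | cell (a : ℕ) (e : NExp)
  | ofNat (e : NExp)
  | add (e₁ e₂ : RExp)
  | sub (e₁ e₂ : RExp)
  | mul (e₁ e₂ : RExp)
  | div (e₁ e₂ : RExp)
  | util (i k : NExp)

/-- Tests. -/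
inductive BExp
  | nlt (e₁ e₂ : NExp)
  | neq (e₁ e₂ : NExp)
  | rlt (e₁ e₂ : RExp)
  | not (b : BExp)
  | and (b₁ b₂ : BExp)
  | or (b₁ b₂ : BExp)

/-- Programs. -/
inductive Cmd
  | skip
  | setN (x : ℕ) (e : NExp)
  | setR (x : ℕ) (e : RExp)
  | putN (a : ℕ) (idx e : NExp)
  | putR (a : ℕ) (idx : NExp) (e : RExp)
  | seq (p q : Cmd)
  | ite (b : BExp) (p q : Cmd)
  | loop (b : BExp) (p : Cmd)

def NExp.eval (s : Store) : NExp → ℕ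
  | .lit k => k
  | .var x => s.nv x
  | .cell a e => s.na a (e.eval s)
  | .add e₁ e₂ => e₁.eval s + e₂.eval s
  | .sub e₁ e₂ => e₁.eval s - e₂.eval s
  | .half e => e.eval s / 2

/-- Every operation costs one step. -/
def NExp.cost : NExp → ℕ
  | .lit _ => 1
  | .var _ => 1
  | .cell _ e => e.cost + 1
  | .add e₁ e₂ => e₁.cost + e₂.cost + 1
  | .sub e₁ e₂ => e₁.cost + e₂.cost + 1
  | .half e => e.cost + 1

/-- `F i k` is the value of the `i`-th utility function at `k` units. -/
def RExp.eval (F : ℕ → ℕ → ℝ) (s : Store) : RExp → ℝ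
  | .var x => s.rv x
  | .cell a e => s.ra a (e.eval s)
  | .ofNat e => (e.eval s : ℝ)
  | .add e₁ e₂ => e₁.eval F s + e₂.eval F s
  | .sub e₁ e₂ => e₁.eval F s - e₂.eval F s
  | .mul e₁ e₂ => e₁.eval F s * e₂.eval F s
  | .div e₁ e₂ => e₁.eval F s / e₂.eval F s
  | .util i k => F (i.eval s) (k.eval s)

def RExp.cost : RExp → ℕ
  | .var _ => 1
  | .cell _ e => e.cost + 1
  | .ofNat e => e.cost + 1
  | .add e₁ e₂ => e₁.cost + e₂.cost + 1
  | .sub e₁ e₂ => e₁.cost + e₂.cost + 1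
  | .mul e₁ e₂ => e₁.cost + e₂.cost + 1
  | .div e₁ e₂ => e₁.cost + e₂.cost + 1
  | .util i k => i.cost + k.cost + 1

def BExp.Holds (F : ℕ → ℕ → ℝ) (s : Store) : BExp → Prop
  | .nlt e₁ e₂ => e₁.eval s < e₂.eval s
  | .neq e₁ e₂ => e₁.eval s = e₂.eval s
  | .rlt e₁ e₂ => e₁.eval F s < e₂.eval F s
  | .not b => ¬ b.Holds F s
  | .and b₁ b₂ => b₁.Holds F s ∧ b₂.Holds F s
  | .or b₁ b₂ => b₁.Holds F s ∨ b₂.Holds F s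

def BExp.cost : BExp → ℕ
  | .nlt e₁ e₂ => e₁.cost + e₂.cost + 1
  | .neq e₁ e₂ => e₁.cost + e₂.cost + 1
  | .rlt e₁ e₂ => e₁.cost + e₂.cost + 1
  | .not b => b.cost + 1
  | .and b₁ b₂ => b₁.cost + b₂.cost + 1
  | .or b₁ b₂ => b₁.cost + b₂.cost + 1

namespace Store

def setN (s : Store) (x v : ℕ) : Store :=
  { s with nv := Function.update s.nv x v }

def setR (s : Store) (x : ℕ) (v : ℝ) : Store :=
  { s with rv := Function.update s.rv x v }

def putN (s : Store) (a idx v : ℕ) : Store :=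
  { s with na := Function.update s.na a (Function.update (s.na a) idx v) }

def putR (s : Store) (a idx : ℕ) (v : ℝ) : Store :=
  { s with ra := Function.update s.ra a (Function.update (s.ra a) idx v) }

end Store

/-- `Exec F p s s' t`: started in `s`, the program `p` halts in `s'` after exactly `t` steps. -/
inductive Exec (F : ℕ → ℕ → ℝ) : Cmd → Store → Store → ℕ → Prop
  | skip (s : Store) : Exec F .skip s s 1
  | setN (x : ℕ) (e : NExp) (s : Store) :
      Exec F (.setN x e) s (s.setN x (e.eval s)) (e.cost + 1)
  | setR (x : ℕ) (e : RExp) (s : Store) :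
      Exec F (.setR x e) s (s.setR x (e.eval F s)) (e.cost + 1)
  | putN (a : ℕ) (idx e : NExp) (s : Store) :
      Exec F (.putN a idx e) s (s.putN a (idx.eval s) (e.eval s)) (idx.cost + e.cost + 1)
  | putR (a : ℕ) (idx : NExp) (e : RExp) (s : Store) :
      Exec F (.putR a idx e) s (s.putR a (idx.eval s) (e.eval F s)) (idx.cost + e.cost + 1)
  | seq {p q : Cmd} {s s₁ s₂ : Store} {t₁ t₂ : ℕ}
      (hp : Exec F p s s₁ t₁) (hq : Exec F q s₁ s₂ t₂) : Exec F (.seq p q) s s₂ (t₁ + t₂)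
  | iteTrue {b : BExp} {p q : Cmd} {s s₁ : Store} {t : ℕ}
      (hb : b.Holds F s) (hp : Exec F p s s₁ t) : Exec F (.ite b p q) s s₁ (b.cost + 1 + t)
  | iteFalse {b : BExp} {p q : Cmd} {s s₁ : Store} {t : ℕ}
      (hb : ¬ b.Holds F s) (hq : Exec F q s s₁ t) : Exec F (.ite b p q) s s₁ (b.cost + 1 + t)
  | loopFalse {b : BExp} {p : Cmd} {s : Store}
      (hb : ¬ b.Holds F s) : Exec F (.loop b p) s s (b.cost + 1)
  | loopTrue {b : BExp} {p : Cmd} {s s₁ s₂ : Store} {t₁ t₂ : ℕ}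
      (hb : b.Holds F s) (hp : Exec F p s s₁ t₁) (hl : Exec F (.loop b p) s₁ s₂ t₂) :
      Exec F (.loop b p) s s₂ (b.cost + 1 + t₁ + t₂)

/-! ## The assignment algorithm as a program

Threads and servers are numbered from `0`. -/

/-- Natural variables: the input `n`, `m`, `C`. -/
abbrev vn : ℕ := 0
abbrev vm : ℕ := 1
abbrev vC : ℕ := 2
/-- Natural variables: the number of unassigned threads, loop counters, the length of the list `U`,
a flag telling whether some pair has been examined, the best pair so far, and an amount of
resource. -/
abbrev vleft : ℕ := 3
abbrev vi : ℕ := 4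
abbrev vj : ℕ := 5
abbrev vk : ℕ := 6
abbrev vlen : ℕ := 7
abbrev vflag : ℕ := 8
abbrev vbi : ℕ := 9
abbrev vbj : ℕ := 10
abbrev vx : ℕ := 11
/-- Natural arrays: the super-optimal allocation, the output `r` and `c`, the remaining resources
`C_j`, the indicator of `R`, and the two coordinates of the list `U`. -/
abbrev ahat : ℕ := 0
abbrev asrv : ℕ := 1
abbrev aalloc : ℕ := 2
abbrev arem : ℕ := 3
abbrev aR : ℕ := 4
abbrev aUi : ℕ := 5
abbrev aUj : ℕ := 6
/-- Real variables: the current and the best utility. -/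
abbrev wg : ℕ := 0
abbrev wbest : ℕ := 1

infixr:60 " ;; " => Cmd.seq

/-- `for x = 0, …, bound - 1 do p`. -/
def forLoop (x bound : ℕ) (p : Cmd) : Cmd :=
  .setN x (.lit 0) ;;
  .loop (.nlt (.var x) (.var bound)) (p ;; .setN x (.add (.var x) (.lit 1)))

/-- `wg ← g_i(x)`, for the values of the variables `i` and `x`. -/
def evalG : Cmd :=
  .ite (.nlt (.var vx) (.cell ahat (.var vi)))
    (.setR wg (.mul (.util (.var vi) (.cell ahat (.var vi)))
      (.div (.ofNat (.var vx)) (.ofNat (.cell ahat (.var vi))))))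
    (.setR wg (.util (.var vi) (.cell ahat (.var vi))))

/-- Make `(i, j)` the best pair if it is the first one or better than the best one so far. -/
def compareBest : Cmd :=
  .ite (.or (.neq (.var vflag) (.lit 0)) (.rlt (.var wbest) (.var wg)))
    (.setR wbest (.var wg) ;; .setN vbi (.var vi) ;; .setN vbj (.var vj) ;;
      .setN vflag (.lit 1))
    .skip

/-- `U ← {(i, j) | i ∈ R, chat_i ≤ C_j}`, as a list of pairs. -/
def computeU : Cmd :=
  .setN vlen (.lit 0) ;;
  forLoop vi vn
    (.ite (.neq (.cell aR (.var vi)) (.lit 1))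
      (forLoop vj vm
        (.ite (.nlt (.cell arem (.var vj)) (.cell ahat (.var vi)))
          .skip
          (.putN aUi (.var vlen) (.var vi) ;; .putN aUj (.var vlen) (.var vj) ;;
            .setN vlen (.add (.var vlen) (.lit 1)))))
      .skip)

/-- The best pair maximizes `g_i(chat_i)` over `(i, j) ∈ U`. -/
def argmaxFull : Cmd :=
  .setN vflag (.lit 0) ;;
  forLoop vk vlen
    (.setN vi (.cell aUi (.var vk)) ;; .setN vj (.cell aUj (.var vk)) ;;
      .setN vx (.cell ahat (.var vi)) ;; evalG ;; compareBest)

/-- The best pair maximizes `g_i(C_j)` over `i ∈ R` and all servers `j`. -/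
def argmaxUnfull : Cmd :=
  .setN vflag (.lit 0) ;;
  forLoop vi vn
    (.ite (.neq (.cell aR (.var vi)) (.lit 1))
      (forLoop vj vm (.setN vx (.cell arem (.var vj)) ;; evalG ;; compareBest))
      .skip)

/-- The assignment algorithm. -/
def assignAlgorithm : Cmd :=
  -- `C_j ← C` for all `j`
  forLoop vj vm (.putN arem (.var vj) (.var vC)) ;;
  -- `R ← {0, …, n - 1}`
  forLoop vi vn (.putN aR (.var vi) (.lit 1)) ;;
  .setN vleft (.var vn) ;;
  -- while `R ≠ ∅`
  .loop (.nlt (.lit 0) (.var vleft))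
    (computeU ;;
      .ite (.nlt (.lit 0) (.var vlen))
        (argmaxFull ;; .putN aalloc (.var vbi) (.cell ahat (.var vbi)))
        (argmaxUnfull ;; .putN aalloc (.var vbi) (.cell arem (.var vbj))) ;;
      -- `r_i ← j`, `R ← R - {i}`, `C_j ← C_j - c_i`
      .putN asrv (.var vbi) (.var vbj) ;;
      .putN aR (.var vbi) (.lit 0) ;;
      .setN vleft (.sub (.var vleft) (.lit 1)) ;;
      .putN arem (.var vbj) (.sub (.cell arem (.var vbj)) (.cell aalloc (.var vbi))))

/-- The initial memory: the three numbers `n`, `m`, `C`, and zeros everywhere else. -/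
def inputStore (n m C : ℕ) : Store where
  nv x := if x = vn then n else if x = vm then m else if x = vC then C else 0
  na _ _ := 0
  rv _ := 0
  ra _ _ := 0

end AA

end

/-! Capping each utility at `C`, that is, using `k ↦ f i (min k C)`, keeps monotonicity and
diminishing gains on all naturals and removes the upper bound on a single thread. It then suffices
to maximize a separable concave sum over vectors of naturals with sum exactly `m * C` and to
truncate the maximizer at `C`. The largest next-unit gain at a maximizer is a Lagrange multiplier `c
≥ 0` (`IsOptimal.exists_multiplier`): every utility lies below a line of slope `c` through its
optimal point. Summing these bounds gives optimality among allocations in whole units. If the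
utilities are affine between units, interpolation extends the bounds to real arguments, hence
optimality to real allocations.

The maximizer is found by greedy scaling. With step `d`, the thread whose next single unit gains
most receives `d` units, as long as `d` units are free. Only the first unit of a step is known to be
worth taking, so at the end every thread that received something returns `d - 1` units. An exchange
argument (`exists_isOptimal_ge`, `GreedyInv.exists_isOptimal`) shows that some maximizer still
dominates the resulting vector. The free amount is then at most `(d - 1) * (n + 1)`, so a phase with
half the step needs at most `2 * (n + 1)` greedy steps. After the phase with `d = 1` nothing is
free, and a vector of full sum dominated by a maximizer is itself a maximizer
(`isOptimal_of_sum_eq`).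

A tournament tree yields each greedy choice in time `O(log n + 1)`, so the first program costs `O(n
(log n + 1) (log (mC) + 1) + m)`. Since `(log n) ^ 2 = O(n)`, the arithmetic-geometric mean
inequality puts this below `m n² + n (log (mC))²`. Algorithm 1 scans `O(mn)` pairs in each of its
`n` rounds, and its store is followed by an invariant that builds the derivation of `Run`. -/

noncomputable section

namespace AA

/-! ## Reasoning about programs -/

/-- `p` does not write the natural variable `x`. -/
def Cmd.keepsNv (x : ℕ) : Cmd → Bool
  | .setN y _ => x != y
  | .seq p q => p.keepsNv x && q.keepsNv x
  | .ite _ p q => p.keepsNv x && q.keepsNv x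
  | .loop _ p => p.keepsNv x
  | _ => true

/-- `p` does not write the natural array `a`. -/
def Cmd.keepsNa (a : ℕ) : Cmd → Bool
  | .putN b _ _ => a != b
  | .seq p q => p.keepsNa a && q.keepsNa a
  | .ite _ p q => p.keepsNa a && q.keepsNa a
  | .loop _ p => p.keepsNa a
  | _ => true

/-- `p` does not write the real variable `x`. -/
def Cmd.keepsRv (x : ℕ) : Cmd → Bool
  | .setR y _ => x != y
  | .seq p q => p.keepsRv x && q.keepsRv x
  | .ite _ p q => p.keepsRv x && q.keepsRv x
  | .loop _ p => p.keepsRv x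
  | _ => true

/-- `p` does not write the real array `a`. -/
def Cmd.keepsRa (a : ℕ) : Cmd → Bool
  | .putR b _ _ => a != b
  | .seq p q => p.keepsRa a && q.keepsRa a
  | .ite _ p q => p.keepsRa a && q.keepsRa a
  | .loop _ p => p.keepsRa a
  | _ => true

/-- `s` and `s'` agree on everything that `p` does not write. -/
structure Frame (p : Cmd) (s s' : Store) : Prop where
  nv : ∀ x, p.keepsNv x = true → s'.nv x = s.nv x
  na : ∀ a, p.keepsNa a = true → s'.na a = s.na a
  rv : ∀ x, p.keepsRv x = true → s'.rv x = s.rv x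
  ra : ∀ a, p.keepsRa a = true → s'.ra a = s.ra a

theorem Frame.refl (p : Cmd) (s : Store) : Frame p s s :=
  ⟨fun _ _ => rfl, fun _ _ => rfl, fun _ _ => rfl, fun _ _ => rfl⟩

theorem Frame.trans {p : Cmd} {s₁ s₂ s₃ : Store} (h : Frame p s₁ s₂) (h' : Frame p s₂ s₃) :
    Frame p s₁ s₃ :=
  ⟨fun x hx => (h'.nv x hx).trans (h.nv x hx), fun x hx => (h'.na x hx).trans (h.na x hx),
    fun x hx => (h'.rv x hx).trans (h.rv x hx), fun x hx => (h'.ra x hx).trans (h.ra x hx)⟩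

theorem Frame.weaken {p q : Cmd} {s s' : Store} (h : Frame p s s')
    (hn : ∀ x, q.keepsNv x = true → p.keepsNv x = true)
    (hna : ∀ x, q.keepsNa x = true → p.keepsNa x = true)
    (hr : ∀ x, q.keepsRv x = true → p.keepsRv x = true)
    (hra : ∀ x, q.keepsRa x = true → p.keepsRa x = true) : Frame q s s' :=
  ⟨fun x hx => h.nv x (hn x hx), fun x hx => h.na x (hna x hx),
    fun x hx => h.rv x (hr x hx), fun x hx => h.ra x (hra x hx)⟩

theorem Frame.seq_left {p q : Cmd} {s s' : Store} (h : Frame p s s') : Frame (p ;; q) s s' := by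
  apply h.weaken <;> intro x hx <;>
    simp_all [Cmd.keepsNv, Cmd.keepsNa, Cmd.keepsRv, Cmd.keepsRa]

theorem Frame.seq_right {p q : Cmd} {s s' : Store} (h : Frame q s s') : Frame (p ;; q) s s' := by
  apply h.weaken <;> intro x hx <;>
    simp_all [Cmd.keepsNv, Cmd.keepsNa, Cmd.keepsRv, Cmd.keepsRa]

theorem Frame.ite_left {b : BExp} {p q : Cmd} {s s' : Store} (h : Frame p s s') :
    Frame (.ite b p q) s s' := by
  apply h.weaken <;> intro x hx <;>
    simp_all [Cmd.keepsNv, Cmd.keepsNa, Cmd.keepsRv, Cmd.keepsRa]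

theorem Frame.ite_right {b : BExp} {p q : Cmd} {s s' : Store} (h : Frame q s s') :
    Frame (.ite b p q) s s' := by
  apply h.weaken <;> intro x hx <;>
    simp_all [Cmd.keepsNv, Cmd.keepsNa, Cmd.keepsRv, Cmd.keepsRa]

theorem Frame.loop {b : BExp} {p : Cmd} {s s' : Store} (h : Frame p s s') :
    Frame (.loop b p) s s' :=
  h.weaken (fun _ h => h) (fun _ h => h) (fun _ h => h) (fun _ h => h)

theorem frame_setN (s : Store) (x : ℕ) (e : NExp) (v : ℕ) :
    Frame (.setN x e) s (s.setN x v) :=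
  ⟨fun y hy => Function.update_of_ne (by simpa [Cmd.keepsNv] using hy) _ _,
    fun _ _ => rfl, fun _ _ => rfl, fun _ _ => rfl⟩

/-- Since `keepsNv` and its companions are Boolean computations on the syntax, every later statement
that a program leaves a variable or array alone is closed by `rfl`. -/
theorem Exec.frame {F : ℕ → ℕ → ℝ} {p : Cmd} {s s' : Store} {t : ℕ} (h : Exec F p s s' t) :
    Frame p s s' := by
  induction h with
  | skip s => exact .refl _ _
  | setN x e s => exact frame_setN _ _ _ _
  | setR x e s =>
    exact ⟨fun _ _ => rfl, fun _ _ => rfl,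
      fun y hy => Function.update_of_ne (by simpa [Cmd.keepsRv] using hy) _ _, fun _ _ => rfl⟩
  | putN a idx e s =>
    exact ⟨fun _ _ => rfl, fun y hy => Function.update_of_ne (by simpa [Cmd.keepsNa] using hy) _ _,
      fun _ _ => rfl, fun _ _ => rfl⟩
  | putR a idx e s =>
    exact ⟨fun _ _ => rfl, fun _ _ => rfl, fun _ _ => rfl,
      fun y hy => Function.update_of_ne (by simpa [Cmd.keepsRa] using hy) _ _⟩
  | seq _ _ hp hq => exact hp.seq_left.trans hq.seq_right
  | iteTrue _ _ h => exact h.ite_left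
  | iteFalse _ _ h => exact h.ite_right
  | loopFalse => exact .refl _ _
  | loopTrue _ _ _ hp hl => exact hp.loop.trans hl

/-- Started in `s`, the program `p` halts after at most `T` steps in a state satisfying `Q`. -/
def Halts (F : ℕ → ℕ → ℝ) (p : Cmd) (s : Store) (T : ℕ) (Q : Store → Prop) : Prop :=
  ∃ s' t, Exec F p s s' t ∧ t ≤ T ∧ Q s'

variable {F : ℕ → ℕ → ℝ} {p q : Cmd} {b : BExp} {s : Store} {T T₁ T₂ : ℕ} {P Q : Store → Prop}

theorem Halts.mono (h : Halts F p s T₁ P) (hT : T₁ ≤ T₂)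
    (hQ : ∀ s', Frame p s s' → P s' → Q s') : Halts F p s T₂ Q := by
  obtain ⟨s', t, h, ht, hP⟩ := h
  exact ⟨s', t, h, ht.trans hT, hQ s' h.frame hP⟩

theorem Halts.seq (h : Halts F p s T₁ P)
    (h' : ∀ s', Frame p s s' → P s' → Halts F q s' T₂ Q) (hT : T₁ + T₂ ≤ T) :
    Halts F (p ;; q) s T Q := by
  obtain ⟨s₁, t₁, h₁, ht₁, hP⟩ := h
  obtain ⟨s₂, t₂, h₂, ht₂, hQ⟩ := h' s₁ h₁.frame hP
  exact ⟨s₂, _, .seq h₁ h₂, by omega, hQ⟩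

theorem halts_ite (hp : b.Holds F s → Halts F p s T Q) (hq : ¬ b.Holds F s → Halts F q s T Q)
    (hT : b.cost + 1 + T ≤ T₁) : Halts F (.ite b p q) s T₁ Q := by
  by_cases hb : b.Holds F s
  · obtain ⟨s', t, h, ht, hQ⟩ := hp hb
    exact ⟨s', _, .iteTrue hb h, by omega, hQ⟩
  · obtain ⟨s', t, h, ht, hQ⟩ := hq hb
    exact ⟨s', _, .iteFalse hb h, by omega, hQ⟩

/-- A loop whose body takes at most `T` steps and lowers a bound `k` for the number of remaining
iterations. -/
theorem halts_loop (I : ℕ → Store → Prop)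
    (hstep : ∀ k s', Frame p s s' → I k s' → b.Holds F s' →
      ∃ k', k = k' + 1 ∧ Halts F p s' T (I k'))
    (k : ℕ) (h0 : I k s) (hT : k * (b.cost + 1 + T) + b.cost + 1 ≤ T₁) :
    Halts F (.loop b p) s T₁ (fun s' => (∃ k', I k' s') ∧ ¬ b.Holds F s') := by
  induction k generalizing s T₁ with
  | zero =>
    by_cases hb : b.Holds F s
    · obtain ⟨k', hk, -⟩ := hstep 0 s (.refl _ _) h0 hb
      omega
    · exact ⟨s, _, .loopFalse hb, by omega, ⟨0, h0⟩, hb⟩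
  | succ k ih =>
    by_cases hb : b.Holds F s
    · obtain ⟨k', hk, s₁, t₁, h₁, ht₁, hI⟩ := hstep _ s (.refl _ _) h0 hb
      obtain rfl : k = k' := by omega
      obtain ⟨s₂, t₂, h₂, ht₂, hQ⟩ := ih (s := s₁)
        (fun k s' hs' => hstep k s' (h₁.frame.trans hs')) hI le_rfl
      refine ⟨s₂, _, .loopTrue hb h₁ h₂, ?_, hQ⟩
      have : (k + 1) * (b.cost + 1 + T) = k * (b.cost + 1 + T) + (b.cost + 1 + T) := by ring
      omega
    · exact ⟨s, _, .loopFalse hb, by omega, ⟨_, h0⟩, hb⟩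

/-- The invariant speaks of the store in which the counter already holds the index. Each round adds
4 steps for the test and 4 for the increment; the final 6 pay for the initialization and the last,
failing test. -/
theorem halts_forLoop {x bound : ℕ} (N : ℕ) (I : ℕ → Store → Prop) (hN : s.nv bound = N)
    (hb : p.keepsNv bound = true) (hx : p.keepsNv x = true) (hne : x ≠ bound)
    (h0 : I 0 (s.setN x 0))
    (hstep : ∀ k < N, ∀ s', Frame (forLoop x bound p) s s' → s'.nv x = k → s'.nv bound = N →
      I k s' → Halts F p s' T (fun s'' => I (k + 1) (s''.setN x (k + 1))))
    (hT : N * (T + 8) + 6 ≤ T₁) :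
    Halts F (forLoop x bound p) s T₁ (I N) := by
  have key := halts_loop (F := F) (b := .nlt (.var x) (.var bound))
    (p := p ;; .setN x (.add (.var x) (.lit 1))) (s := s.setN x 0) (T := T + 4)
    (T₁ := N * (T + 8) + 4)
    (fun k s' => s'.nv x + k = N ∧ s'.nv bound = N ∧ I (s'.nv x) s') ?_ N ?_ ?_
  · obtain ⟨s', t, h, ht, ⟨k, h1, h2, h3⟩, h4⟩ := key
    refine ⟨s', _, .seq (.setN x (.lit 0) s) h, ?_, ?_⟩
    · simp [NExp.cost]; omega
    · have : s'.nv x = N := by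
        simp [BExp.Holds, NExp.eval] at h4; omega
      exact this ▸ h3
  · rintro k s' hs' ⟨h1, h2, h3⟩ hlt
    have hlt' : s'.nv x < N := by simpa [BExp.Holds, NExp.eval, h2] using hlt
    refine ⟨k - 1, by omega, ?_⟩
    have hf : Frame (forLoop x bound p) s s' :=
      (frame_setN s x (.lit 0) 0).seq_left.trans hs'.loop.seq_right
    obtain ⟨s₁, t₁, e₁, ht₁, hI⟩ := hstep _ hlt' s' hf rfl h2 h3
    have hx' := e₁.frame.nv x hx
    refine ⟨_, _, .seq e₁ (.setN _ _ _), by simp [NExp.cost]; omega, ?_⟩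
    simp only [NExp.eval, hx']
    refine ⟨?_, ?_, ?_⟩
    · simp [Store.setN]; omega
    · simp [Store.setN, hne.symm, e₁.frame.nv bound hb, h2]
    · have : (s₁.setN x (s'.nv x + 1)).nv x = s'.nv x + 1 := by simp [Store.setN]
      rw [this]; exact hI
  · refine ⟨by simp [Store.setN], by simp [Store.setN, hne.symm, hN], ?_⟩
    have : (s.setN x 0).nv x = 0 := by simp [Store.setN]
    rw [this]; exact h0
  · simp only [BExp.cost, NExp.cost]
    have : N * (1 + 1 + 1 + 1 + (T + 4)) = N * (T + 8) := by ring
    omega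

/-! Programs without loops -/

def Cmd.loopFree : Cmd → Bool
  | .seq p q => p.loopFree && q.loopFree
  | .ite _ p q => p.loopFree && q.loopFree
  | .loop _ _ => false
  | _ => true

/-- An upper bound for the running time of a program without loops. -/
def Cmd.time : Cmd → ℕ
  | .skip => 1
  | .setN _ e => e.cost + 1
  | .setR _ e => e.cost + 1
  | .putN _ i e => i.cost + e.cost + 1
  | .putR _ i e => i.cost + e.cost + 1
  | .seq p q => p.time + q.time
  | .ite b p q => b.cost + 1 + (p.time + q.time)
  -- A junk value: this case is excluded by `loopFree` wherever the bound is used.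
  | .loop _ _ => 0

open Classical in
/-- The final state of a program without loops. -/
def Cmd.run (F : ℕ → ℕ → ℝ) : Cmd → Store → Store
  | .skip, s => s
  | .setN x e, s => s.setN x (e.eval s)
  | .setR x e, s => s.setR x (e.eval F s)
  | .putN a i e, s => s.putN a (i.eval s) (e.eval s)
  | .putR a i e, s => s.putR a (i.eval s) (e.eval F s)
  | .seq p q, s => q.run F (p.run F s)
  | .ite b p q, s => if b.Holds F s then p.run F s else q.run F s
  | .loop _ _, s => s

theorem Cmd.exec_run (F : ℕ → ℕ → ℝ) (p : Cmd) (hp : p.loopFree = true) (s : Store) :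
    ∃ t ≤ p.time, Exec F p s (p.run F s) t := by
  induction p generalizing s with
  | skip => exact ⟨_, le_rfl, .skip s⟩
  | setN x e => exact ⟨_, le_rfl, .setN x e s⟩
  | setR x e => exact ⟨_, le_rfl, .setR x e s⟩
  | putN a i e => exact ⟨_, le_rfl, .putN a i e s⟩
  | putR a i e => exact ⟨_, le_rfl, .putR a i e s⟩
  | seq p q hp' hq' =>
    simp only [Cmd.loopFree, Bool.and_eq_true] at hp
    obtain ⟨t₁, h₁, e₁⟩ := hp' hp.1 s
    obtain ⟨t₂, h₂, e₂⟩ := hq' hp.2 (p.run F s)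
    exact ⟨_, by simp only [Cmd.time]; omega, .seq e₁ e₂⟩
  | ite b p q hp' hq' =>
    simp only [Cmd.loopFree, Bool.and_eq_true] at hp
    obtain ⟨t₁, h₁, e₁⟩ := hp' hp.1 s
    obtain ⟨t₂, h₂, e₂⟩ := hq' hp.2 s
    by_cases hb : b.Holds F s
    · refine ⟨b.cost + 1 + t₁, by simp only [Cmd.time]; omega, ?_⟩
      simpa only [Cmd.run, if_pos hb] using .iteTrue hb e₁
    · refine ⟨b.cost + 1 + t₂, by simp only [Cmd.time]; omega, ?_⟩
      simpa only [Cmd.run, if_neg hb] using .iteFalse hb e₂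
  | loop => simp [Cmd.loopFree] at hp

/-- Symbolic execution: the syntactic test and the time bound are evaluated, and the postcondition
is checked on the computed final store. -/
theorem halts_of_loopFree (hp : p.loopFree = true) (hT : p.time ≤ T) (hQ : Q (p.run F s)) :
    Halts F p s T Q := by
  obtain ⟨t, ht, h⟩ := p.exec_run F hp s
  exact ⟨_, t, h, ht.trans hT, hQ⟩

/-! ### Reading the memory after a write -/

section
variable (s) (x v a i y j : ℕ) (w : ℝ)

@[simp] theorem Store.nv_setN : (s.setN x v).nv y = if y = x then v else s.nv y := by
  simp [Store.setN, Function.update_apply]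
@[simp] theorem Store.na_setN : (s.setN x v).na = s.na := rfl
@[simp] theorem Store.rv_setN : (s.setN x v).rv = s.rv := rfl
@[simp] theorem Store.ra_setN : (s.setN x v).ra = s.ra := rfl
@[simp] theorem Store.nv_setR : (s.setR x w).nv = s.nv := rfl
@[simp] theorem Store.na_setR : (s.setR x w).na = s.na := rfl
@[simp] theorem Store.rv_setR : (s.setR x w).rv y = if y = x then w else s.rv y := by
  simp [Store.setR, Function.update_apply]
@[simp] theorem Store.ra_setR : (s.setR x w).ra = s.ra := rfl
@[simp] theorem Store.nv_putN : (s.putN a i v).nv = s.nv := rfl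
@[simp] theorem Store.na_putN :
    (s.putN a i v).na y = if y = a then Function.update (s.na a) i v else s.na y := by
  simp [Store.putN, Function.update_apply]
@[simp] theorem Store.rv_putN : (s.putN a i v).rv = s.rv := rfl
@[simp] theorem Store.ra_putN : (s.putN a i v).ra = s.ra := rfl
@[simp] theorem Store.nv_putR : (s.putR a i w).nv = s.nv := rfl
@[simp] theorem Store.na_putR : (s.putR a i w).na = s.na := rfl
@[simp] theorem Store.rv_putR : (s.putR a i w).rv = s.rv := rfl
@[simp] theorem Store.ra_putR :
    (s.putR a i w).ra y = if y = a then Function.update (s.ra a) i w else s.ra y := by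
  simp [Store.putR, Function.update_apply]
end

end AA

end

noncomputable section

namespace AA

/-! ## The assignment algorithm -/

attribute [local simp] vn vm vC vleft vi vj vk vlen vflag vbi vbj vx ahat asrv aalloc arem aR aUi aUj
  wg wbest

variable {F : ℕ → ℕ → ℝ} {s : Store}

/-- The linearized utility functions in terms of the oracle. -/
def gval (F : ℕ → ℕ → ℝ) (hat : ℕ → ℕ) (i x : ℕ) : ℝ :=
  if x < hat i then F i (hat i) * ((x : ℝ) / (hat i : ℝ)) else F i (hat i)

/-- The variables for the best pair hold a pair that maximizes `val` among those satisfying `P`. -/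
def Best (val : ℕ → ℕ → ℝ) (P : ℕ → ℕ → Prop) (s : Store) : Prop :=
  (s.nv vflag = 0 ∧ ∀ i j, ¬ P i j) ∨
  (s.nv vflag = 1 ∧ P (s.nv vbi) (s.nv vbj) ∧ s.rv wbest = val (s.nv vbi) (s.nv vbj) ∧
    ∀ i j, P i j → val i j ≤ s.rv wbest)

theorem Best.congr {val : ℕ → ℕ → ℝ} {P P' : ℕ → ℕ → Prop} (h : Best val P s)
    (hP : ∀ i j, P i j ↔ P' i j) : Best val P' s := by
  obtain rfl : P = P' := by ext i j; exact hP i j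
  exact h

theorem Best.of_eq {val : ℕ → ℕ → ℝ} {P : ℕ → ℕ → Prop} {s' : Store} (h : Best val P s)
    (h1 : s'.nv vflag = s.nv vflag) (h2 : s'.nv vbi = s.nv vbi) (h3 : s'.nv vbj = s.nv vbj)
    (h4 : s'.rv = s.rv) : Best val P s' := by
  unfold Best at *
  rwa [h1, h2, h3, h4]

theorem Best.max {val : ℕ → ℕ → ℝ} {P : ℕ → ℕ → Prop} (h : Best val P s) (hP : ∃ i j, P i j) :
    P (s.nv vbi) (s.nv vbj) ∧ ∀ i j, P i j → val i j ≤ val (s.nv vbi) (s.nv vbj) := by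
  rcases h with ⟨-, h⟩ | ⟨-, h1, h2, h3⟩
  · obtain ⟨i, j, hij⟩ := hP
    exact absurd hij (h i j)
  · exact ⟨h1, h2 ▸ h3⟩

/-- One round of either maximum search: the current pair joins the set of pairs already examined.
The function `val` is arbitrary so that both searches can use this. -/
theorem halts_evalG_compareBest {val : ℕ → ℕ → ℝ} {P : ℕ → ℕ → Prop} (h : Best val P s)
    (hval : val (s.nv vi) (s.nv vj) = gval F (s.na ahat) (s.nv vi) (s.nv vx)) :
    Halts F (evalG ;; compareBest) s 60
      (Best val (fun i j => P i j ∨ (i = s.nv vi ∧ j = s.nv vj))) := by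
  refine Halts.seq (T₁ := 30) (T₂ := 30)
    (P := fun s' => s'.rv wg = val (s.nv vi) (s.nv vj) ∧ s'.rv wbest = s.rv wbest) ?_ ?_ le_rfl
  · refine halts_of_loopFree rfl (by decide) ?_
    rw [hval]
    by_cases hx : s.nv vx < s.na ahat (s.nv vi) <;>
      simp_all [evalG, Cmd.run, BExp.Holds, NExp.eval, RExp.eval, gval, not_lt_of_ge]
  · rintro s' hf ⟨hg, hb⟩
    have e1 := hf.nv vi rfl
    have e2 := hf.nv vj rfl
    -- `evalG` writes only `wg`, so the record of the best pair survives it.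
    have h' : Best val P s' := by
      unfold Best at *
      rwa [hf.nv vflag rfl, hf.nv vbi rfl, hf.nv vbj rfl, hb]
    rw [← e1, ← e2] at hg ⊢
    refine halts_of_loopFree rfl (by decide) ?_
    rcases h' with ⟨h0, hP⟩ | ⟨h0, hP, hbest, hmax⟩
    · right
      have hr : compareBest.run F s' =
          (((s'.setR wbest (s'.rv wg)).setN vbi (s'.nv vi)).setN vbj (s'.nv vj)).setN vflag 1 := by
        simp_all [compareBest, Cmd.run, BExp.Holds, NExp.eval, RExp.eval]
      rw [hr]
      simp_all
    · by_cases hlt : s'.rv wbest < s'.rv wg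
      · right
        have hr : compareBest.run F s' =
            (((s'.setR wbest (s'.rv wg)).setN vbi (s'.nv vi)).setN vbj (s'.nv vj)).setN
              vflag 1 := by
          simp_all [compareBest, Cmd.run, BExp.Holds, NExp.eval, RExp.eval]
        rw [hr]
        simp only [vflag, vbi, vbj, vi, vj, wbest, wg] at *
        simp
        refine ⟨hg, ?_⟩
        rintro i j (h | ⟨rfl, rfl⟩)
        · exact (hmax i j h).trans hlt.le
        · exact hg.ge
      · right
        have hr : compareBest.run F s' = s' := by
          simp_all [compareBest, Cmd.run, BExp.Holds, NExp.eval, RExp.eval]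
        rw [hr]
        refine ⟨h0, .inl hP, hbest, ?_⟩
        rintro i j (h | ⟨rfl, rfl⟩)
        · exact hmax i j h
        · rw [← hg]; exact not_lt.1 hlt

theorem halts_argmaxFull :
    Halts F argmaxFull s (s.nv vlen * 80 + 10)
      (Best (fun i _ => gval F (s.na ahat) i (s.na ahat i))
        (fun i j => ∃ l < s.nv vlen, s.na aUi l = i ∧ s.na aUj l = j)) := by
  set val : ℕ → ℕ → ℝ := fun i _ => gval F (s.na ahat) i (s.na ahat i) with hval
  refine Halts.seq (T₁ := 2) (T₂ := s.nv vlen * 80 + 6) (P := fun s' => s' = s.setN vflag 0)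
    (halts_of_loopFree rfl (by decide) rfl) ?_ (by omega)
  rintro s₁ hf₁ rfl
  refine halts_forLoop (T := 72) (s.nv vlen)
    (fun k => Best val (fun i j => ∃ l < k, s.na aUi l = i ∧ s.na aUj l = j))
    (by simp) rfl rfl (by simp) ?_ ?_ (by omega)
  · left; simp
  · intro k hk s₂ hf₂ hk₂ _ hI
    have ehat : s₂.na ahat = s.na ahat := hf₂.na ahat rfl
    have eUi : s₂.na aUi = s.na aUi := hf₂.na aUi rfl
    have eUj : s₂.na aUj = s.na aUj := hf₂.na aUj rfl
    refine Halts.seq (T₁ := 3) (T₂ := 69) (P := fun s' => s' = s₂.setN vi (s.na aUi k))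
      (halts_of_loopFree rfl (by decide) (by simp_all [Cmd.run, NExp.eval])) ?_ (by omega)
    rintro _ - rfl
    refine Halts.seq (T₁ := 3) (T₂ := 66)
      (P := fun s' => s' = (s₂.setN vi (s.na aUi k)).setN vj (s.na aUj k))
      (halts_of_loopFree rfl (by decide) (by simp_all [Cmd.run, NExp.eval])) ?_ (by omega)
    rintro _ - rfl
    refine Halts.seq (T₁ := 3) (T₂ := 63)
      (P := fun s' => s' = ((s₂.setN vi (s.na aUi k)).setN vj (s.na aUj k)).setN vx
        (s.na ahat (s.na aUi k)))
      (halts_of_loopFree rfl (by decide) (by simp_all [Cmd.run, NExp.eval])) ?_ (by omega)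
    rintro _ - rfl
    have hB := hI.of_eq (s' := ((s₂.setN vi (s.na aUi k)).setN vj (s.na aUj k)).setN vx
      (s.na ahat (s.na aUi k))) (by simp) (by simp) (by simp) rfl
    refine (halts_evalG_compareBest hB ?_).mono ?_ ?_
    · simp_all
    · norm_num
    · intro s₃ _ h
      refine Best.of_eq (h.congr ?_) (by simp) (by simp) (by simp) rfl
      intro i j
      constructor
      · rintro (⟨l, hl, h⟩ | ⟨rfl, rfl⟩)
        · exact ⟨l, by omega, h⟩
        · exact ⟨k, by omega, by simp⟩
      · rintro ⟨l, hl, h1, h2⟩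
        by_cases hlk : l < k
        · exact .inl ⟨l, hlk, h1, h2⟩
        · obtain rfl : l = k := by omega
          right; simp_all

theorem halts_argmaxUnfull :
    Halts F argmaxUnfull s (s.nv vn * (s.nv vm * 80 + 30) + 10)
      (Best (fun i j => gval F (s.na ahat) i (s.na arem j))
        (fun i j => i < s.nv vn ∧ s.na aR i = 1 ∧ j < s.nv vm)) := by
  set val : ℕ → ℕ → ℝ := fun i j => gval F (s.na ahat) i (s.na arem j) with hval
  refine Halts.seq (T₁ := 2) (T₂ := s.nv vn * (s.nv vm * 80 + 30) + 6)
    (P := fun s' => s' = s.setN vflag 0) (halts_of_loopFree rfl (by decide) rfl) ?_ (by omega)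
  rintro s₁ hf₁ rfl
  refine halts_forLoop (T := s.nv vm * 80 + 22) (s.nv vn)
    (fun k => Best val (fun i j => i < k ∧ s.na aR i = 1 ∧ j < s.nv vm))
    (by simp) rfl rfl (by simp) ?_ ?_ (by simp only [add_assoc]; norm_num)
  · left; simp
  · intro k hk s₂ hf₂ hk₂ hn₂ hI
    have ehat : s₂.na ahat = s.na ahat := hf₂.na ahat rfl
    have erem : s₂.na arem = s.na arem := hf₂.na arem rfl
    have eR : s₂.na aR = s.na aR := hf₂.na aR rfl
    have em : s₂.nv vm = s.nv vm := hf₂.nv vm rfl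
    refine halts_ite (T := s.nv vm * 80 + 10) ?_ ?_ (by simp [BExp.cost, NExp.cost]; omega)
    · intro hR
      have hR : s.na aR k = 1 := by simpa [BExp.Holds, NExp.eval, eR, hk₂] using hR
      refine (halts_forLoop (T := 72) (T₁ := s.nv vm * 80 + 10) (s.nv vm)
        (fun j => Best val (fun i' j' => (i' < k ∧ s.na aR i' = 1 ∧ j' < s.nv vm) ∨
          (i' = k ∧ j' < j)))
        em rfl rfl (by simp) ?_ ?_ (by omega)).mono le_rfl ?_
      · exact (hI.congr (by simp)).of_eq (by simp) (by simp) (by simp) rfl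
      · intro j hj s₃ hf₃ hj₃ _ hJ
        have ehat₃ : s₃.na ahat = s.na ahat := (hf₃.na ahat rfl).trans ehat
        have erem₃ : s₃.na arem = s.na arem := (hf₃.na arem rfl).trans erem
        have ei₃ : s₃.nv vi = k := (hf₃.nv vi rfl).trans hk₂
        refine Halts.seq (T₁ := 3) (T₂ := 69) (P := fun s' => s' = s₃.setN vx (s.na arem j))
          (halts_of_loopFree rfl (by decide) (by simp_all [Cmd.run, NExp.eval])) ?_ (by omega)
        rintro _ - rfl
        have hB := hJ.of_eq (s' := s₃.setN vx (s.na arem j)) (by simp) (by simp) (by simp) rfl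
        refine (halts_evalG_compareBest hB ?_).mono ?_ ?_
        · simp_all
        · norm_num
        · intro s₄ _ h
          refine Best.of_eq (h.congr ?_) (by simp) (by simp) (by simp) rfl
          intro i' j'
          have e1 : (s₃.setN vx (s.na arem j)).nv vi = k := by simp_all
          have e2 : (s₃.setN vx (s.na arem j)).nv vj = j := by simp_all
          rw [e1, e2]
          omega
      · intro s₄ _ h
        refine Best.of_eq (h.congr ?_) (by simp) (by simp) (by simp) rfl
        intro i' j'
        constructor
        · rintro (⟨h1, h2, h3⟩ | ⟨rfl, h1⟩)
          · exact ⟨by omega, h2, h3⟩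
          · exact ⟨by omega, hR, h1⟩
        · rintro ⟨h1, h2, h3⟩
          omega
    · intro hR
      have hR : s.na aR k ≠ 1 := by simpa [BExp.Holds, NExp.eval, eR, hk₂] using hR
      refine halts_of_loopFree rfl (by simp [Cmd.time]) ?_
      refine Best.of_eq (hI.congr ?_) (by simp [Cmd.run]) (by simp [Cmd.run])
        (by simp [Cmd.run]) rfl
      intro i j
      constructor
      · rintro ⟨h1, h2, h3⟩
        exact ⟨by omega, h2, h3⟩
      · rintro ⟨h1, h2, h3⟩
        refine ⟨?_, h2, h3⟩
        by_contra hc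
        obtain rfl : i = k := by omega
        exact hR h2

/-! ### The list of pairs that still fit -/

/-- The list `U` has at most `L` entries and consists of the pairs satisfying `P`. -/
def ListsU (L : ℕ) (P : ℕ → ℕ → Prop) (s : Store) : Prop :=
  s.nv vlen ≤ L ∧ ∀ i j, (∃ l < s.nv vlen, s.na aUi l = i ∧ s.na aUj l = j) ↔ P i j

theorem ListsU.of_eq {L L' : ℕ} {P P' : ℕ → ℕ → Prop} {s' : Store} (h : ListsU L P s)
    (h1 : s'.nv vlen = s.nv vlen) (h2 : s'.na = s.na) (hL : L ≤ L')
    (hP : ∀ i j, P i j ↔ P' i j) : ListsU L' P' s' := by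
  unfold ListsU at *
  rw [h1, h2]
  exact ⟨h.1.trans hL, fun i j => (h.2 i j).trans (hP i j)⟩

theorem ListsU.push {L : ℕ} {P : ℕ → ℕ → Prop} (h : ListsU L P s) :
    ListsU (L + 1) (fun i j => P i j ∨ (i = s.nv vi ∧ j = s.nv vj))
      (((s.putN aUi (s.nv vlen) (s.nv vi)).putN aUj (s.nv vlen) (s.nv vj)).setN vlen
        (s.nv vlen + 1)) := by
  obtain ⟨h1, h2⟩ := h
  refine ⟨by simpa using h1, fun i j => ?_⟩
  refine Iff.trans ?_ (or_congr_left (h2 i j))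
  simp only [aUi, aUj, vlen, Store.nv_setN, Store.na_setN, Store.na_putN, Store.nv_putN]
  -- The numerals 5 and 6 are the arrays `aUi` and `aUj`; the 7 below is the variable `vlen`.
  simp only [if_true, if_false, show ¬ (5 = 6) by decide, show ¬ (6 = 5) by decide]
  constructor
  · rintro ⟨l, hl, hi, hj⟩
    by_cases hlk : l = s.nv 7
    · right
      subst hlk
      simp_all
    · left
      rw [Function.update_of_ne hlk] at hi hj
      exact ⟨l, by omega, hi, hj⟩
  · rintro (⟨l, hl, hi, hj⟩ | ⟨rfl, rfl⟩)
    · have hlk : l ≠ s.nv 7 := by omega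
      refine ⟨l, by omega, ?_⟩
      rw [Function.update_of_ne hlk, Function.update_of_ne hlk]
      exact ⟨hi, hj⟩
    · exact ⟨s.nv 7, by omega, by simp⟩

/-- The length bound `n * m` matters as much as the contents: it bounds the time of the search
through the list. -/
theorem halts_computeU :
    Halts F computeU s (s.nv vn * (s.nv vm * 40 + 30) + 10)
      (ListsU (s.nv vn * s.nv vm) (fun i j => i < s.nv vn ∧ s.na aR i = 1 ∧ j < s.nv vm ∧
        s.na ahat i ≤ s.na arem j)) := by
  refine Halts.seq (T₁ := 2) (T₂ := s.nv vn * (s.nv vm * 40 + 30) + 6)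
    (P := fun s' => s' = s.setN vlen 0) (halts_of_loopFree rfl (by decide) rfl) ?_ (by omega)
  rintro s₁ hf₁ rfl
  refine halts_forLoop (T := s.nv vm * 40 + 22) (s.nv vn)
    (fun k => ListsU (k * s.nv vm) (fun i j => i < k ∧ s.na aR i = 1 ∧ j < s.nv vm ∧
        s.na ahat i ≤ s.na arem j))
    (by simp) rfl rfl (by simp) ?_ ?_ (by simp only [add_assoc]; norm_num)
  · exact ⟨by simp, by simp⟩
  · intro k hk s₂ hf₂ hk₂ hn₂ hI
    have ehat : s₂.na ahat = s.na ahat := hf₂.na ahat rfl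
    have erem : s₂.na arem = s.na arem := hf₂.na arem rfl
    have eR : s₂.na aR = s.na aR := hf₂.na aR rfl
    have em : s₂.nv vm = s.nv vm := hf₂.nv vm rfl
    have hkm : k * s.nv vm ≤ (k + 1) * s.nv vm := Nat.mul_le_mul_right _ (by omega)
    refine halts_ite (T := s.nv vm * 40 + 10) ?_ ?_ (by simp [BExp.cost, NExp.cost]; omega)
    · intro hR
      have hR : s.na aR k = 1 := by simpa [BExp.Holds, NExp.eval, eR, hk₂] using hR
      refine (halts_forLoop (T := 32) (T₁ := s.nv vm * 40 + 10) (s.nv vm)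
        (fun j => ListsU (k * s.nv vm + j) (fun i' j' => (i' < k ∧ s.na aR i' = 1 ∧
          j' < s.nv vm ∧ s.na ahat i' ≤ s.na arem j') ∨
          (i' = k ∧ j' < j ∧ s.na ahat i' ≤ s.na arem j')))
        em rfl rfl (by simp) ?_ ?_ (by omega)).mono le_rfl ?_
      · exact hI.of_eq (by simp) rfl le_rfl (by simp)
      · intro j hj s₃ hf₃ hj₃ _ hJ
        have ehat₃ : s₃.na ahat = s.na ahat := (hf₃.na ahat rfl).trans ehat
        have erem₃ : s₃.na arem = s.na arem := (hf₃.na arem rfl).trans erem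
        have ei₃ : s₃.nv vi = k := (hf₃.nv vi rfl).trans hk₂
        refine halts_of_loopFree rfl (by decide) ?_
        by_cases hle : s.na arem j < s.na ahat k
        · refine hJ.of_eq (by simp_all [Cmd.run, BExp.Holds, NExp.eval])
            (by simp_all [Cmd.run, BExp.Holds, NExp.eval]) (by omega) ?_
          intro i' j'
          constructor
          · rintro (h | ⟨rfl, h1, h2⟩)
            · exact .inl h
            · exact .inr ⟨rfl, by omega, h2⟩
          · rintro (h | ⟨rfl, h1, h2⟩)
            · exact .inl h
            · refine .inr ⟨rfl, ?_, h2⟩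
              by_contra hc
              obtain rfl : j' = j := by omega
              omega
        · refine ListsU.of_eq hJ.push (by simp_all [Cmd.run, BExp.Holds, NExp.eval, not_lt_of_ge])
            (by simp_all [Cmd.run, BExp.Holds, NExp.eval, not_lt_of_ge]) (by omega) ?_
          intro i' j'
          rw [ei₃, hj₃]
          constructor
          · rintro ((h | ⟨rfl, h1, h2⟩) | ⟨rfl, rfl⟩)
            · exact .inl h
            · exact .inr ⟨rfl, by omega, h2⟩
            · exact .inr ⟨rfl, by omega, not_lt.1 hle⟩
          · rintro (h | ⟨rfl, h1, h2⟩)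
            · exact .inl (.inl h)
            · by_cases hc : j' < j
              · exact .inl (.inr ⟨rfl, hc, h2⟩)
              · exact .inr ⟨rfl, by omega⟩
      · intro s₄ _ h
        refine h.of_eq (by simp) rfl (by rw [add_mul]; omega) ?_
        intro i' j'
        constructor
        · rintro (⟨h1, h2⟩ | ⟨rfl, h1, h2⟩)
          · exact ⟨by omega, h2⟩
          · exact ⟨by omega, hR, h1, h2⟩
        · rintro ⟨h1, h2, h3, h4⟩
          omega
    · intro hR
      have hR : s.na aR k ≠ 1 := by simpa [BExp.Holds, NExp.eval, eR, hk₂] using hR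
      refine halts_of_loopFree rfl (by simp [Cmd.time]) ?_
      refine hI.of_eq (by simp [Cmd.run]) rfl hkm ?_
      intro i j
      constructor
      · rintro ⟨h1, h2⟩
        exact ⟨by omega, h2⟩
      · rintro ⟨h1, h2⟩
        refine ⟨?_, h2⟩
        by_contra hc
        obtain rfl : i = k := by omega
        exact hR h2.1

end AA

end

/-! ### The main loop of the assignment algorithm -/

noncomputable section

namespace AA

attribute [local simp] vn vm vC vleft vi vj vk vlen vflag vbi vbj vx ahat asrv aalloc arem aR aUi aUj
  wg wbest

variable {F : ℕ → ℕ → ℝ} {s : Store}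

/-- The pair `(i, j)` and the amount `c` are a possible choice of the assignment algorithm, with
super-optimal allocation `hat`, remaining resources `rem` and unassigned threads `{i | R i = 1}`. -/
def Choice (F : ℕ → ℕ → ℝ) (n m : ℕ) (hat rem R : ℕ → ℕ) (i j c : ℕ) : Prop :=
  (i < n ∧ R i = 1 ∧ j < m) ∧
  ((hat i ≤ rem j ∧ c = hat i ∧ ∀ i' j', i' < n → R i' = 1 → j' < m → hat i' ≤ rem j' →
      gval F hat i' (hat i') ≤ gval F hat i (hat i)) ∨
    (c = rem j ∧ (∀ i' j', i' < n → R i' = 1 → j' < m → rem j' < hat i') ∧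
      ∀ i' j', i' < n → R i' = 1 → j' < m → gval F hat i' (rem j') ≤ gval F hat i (rem j)))

theorem Choice.le {n m : ℕ} {hat rem R : ℕ → ℕ} {i j c : ℕ} (h : Choice F n m hat rem R i j c) :
    c ≤ rem j := by
  rcases h.2 with h | h <;> omega

/-- The body of the main loop of the assignment algorithm. -/
def assignStep : Cmd :=
  computeU ;;
    .ite (.nlt (.lit 0) (.var vlen))
      (argmaxFull ;; .putN aalloc (.var vbi) (.cell ahat (.var vbi)))
      (argmaxUnfull ;; .putN aalloc (.var vbi) (.cell arem (.var vbj))) ;;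
    .putN asrv (.var vbi) (.var vbj) ;;
    .putN aR (.var vbi) (.lit 0) ;;
    .setN vleft (.sub (.var vleft) (.lit 1)) ;;
    .putN arem (.var vbj) (.sub (.cell arem (.var vbj)) (.cell aalloc (.var vbi)))

/-- An unassigned thread and a server exist, so `n * m ≥ 1` and lower-order terms are absorbed into
multiples of `n * m`. They also give the second search a candidate when the list is empty. -/
theorem halts_assignStep (hR : ∃ i < s.nv vn, s.na aR i = 1) (hm : 0 < s.nv vm) :
    Halts F assignStep s (300 * (s.nv vn * s.nv vm)) (fun s' => ∃ i j c,
      Choice F (s.nv vn) (s.nv vm) (s.na ahat) (s.na arem) (s.na aR) i j c ∧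
      s'.na asrv = Function.update (s.na asrv) i j ∧
      s'.na aalloc = Function.update (s.na aalloc) i c ∧
      s'.na aR = Function.update (s.na aR) i 0 ∧
      s'.na arem = Function.update (s.na arem) j (s.na arem j - c) ∧
      s'.nv vleft = s.nv vleft - 1) := by
  obtain ⟨i₀, hi₀, hR₀⟩ := hR
  generalize hn : s.nv vn = n at *
  generalize hm' : s.nv vm = m at *
  have hnm : n ≤ n * m := Nat.le_mul_of_pos_right _ hm
  have hd : n * (m * 40 + 30) = 40 * (n * m) + 30 * n := by ring
  have hd' : n * (m * 80 + 30) = 80 * (n * m) + 30 * n := by ring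
  refine Halts.seq (T₁ := 80 * (n * m)) (T₂ := 220 * (n * m))
    (halts_computeU.mono (by rw [hn, hm']; omega) fun _ _ h => h) ?_ (by omega)
  rw [hn, hm']
  rintro s₁ f₁ ⟨hlen, hU⟩
  have n₁ : s₁.nv vn = n := (f₁.nv vn rfl).trans hn
  have m₁ : s₁.nv vm = m := (f₁.nv vm rfl).trans hm'
  have ehat : s₁.na ahat = s.na ahat := f₁.na ahat rfl
  have erem : s₁.na arem = s.na arem := f₁.na arem rfl
  have eR : s₁.na aR = s.na aR := f₁.na aR rfl
  have ealloc : s₁.na aalloc = s.na aalloc := f₁.na aalloc rfl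
  refine Halts.seq (T₁ := 180 * (n * m)) (T₂ := 40) (P := fun s' => ∃ c,
      Choice F n m (s.na ahat) (s.na arem) (s.na aR) (s'.nv vbi) (s'.nv vbj) c ∧
      s'.na aalloc = Function.update (s.na aalloc) (s'.nv vbi) c)
    (halts_ite (T := 170 * (n * m)) ?_ ?_ (by simp [BExp.cost, NExp.cost]; omega)) ?_ (by omega)
  · intro hlt
    have hlt : 0 < s₁.nv vlen := by simpa [BExp.Holds, NExp.eval] using hlt
    refine Halts.seq (halts_argmaxFull (F := F)) (T₂ := 10) ?_ (by omega)
    intro s₂ f₂ hb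
    obtain ⟨hb1, hb2⟩ := hb.max ⟨_, _, 0, hlt, rfl, rfl⟩
    rw [hU] at hb1
    refine halts_of_loopFree rfl (by decide) ⟨s.na ahat (s₂.nv vbi), ⟨⟨hb1.1, hb1.2.1, hb1.2.2.1⟩,
      .inl ⟨hb1.2.2.2, rfl, ?_⟩⟩, ?_⟩
    · intro i' j' h1 h2 h3 h4
      rw [← ehat]
      exact hb2 i' j' ((hU _ _).2 ⟨h1, h2, h3, h4⟩)
    · have := f₂.na ahat rfl
      have := f₂.na aalloc rfl
      simp_all [Cmd.run, NExp.eval]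
  · intro hlt
    have hlt : s₁.nv vlen = 0 := by simpa [BExp.Holds, NExp.eval] using hlt
    refine Halts.seq (halts_argmaxUnfull (F := F)) (T₂ := 10) ?_ (by rw [n₁, m₁]; omega)
    rw [n₁, m₁, ehat, erem, eR]
    intro s₂ f₂ hb
    obtain ⟨hb1, hb2⟩ := hb.max ⟨i₀, 0, hi₀, hR₀, hm⟩
    refine halts_of_loopFree rfl (by decide) ⟨s.na arem (s₂.nv vbj), ⟨hb1,
      .inr ⟨rfl, ?_, ?_⟩⟩, ?_⟩
    · intro i' j' h1 h2 h3
      by_contra hc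
      obtain ⟨l, hl, -⟩ := (hU i' j').2 ⟨h1, h2, h3, not_lt.1 hc⟩
      omega
    · exact fun i' j' h1 h2 h3 => hb2 i' j' ⟨h1, h2, h3⟩
    · have := f₂.na arem rfl
      have := f₂.na aalloc rfl
      simp_all [Cmd.run, NExp.eval]
  · rintro s₂ f₂ ⟨c, hc, hal⟩
    refine halts_of_loopFree rfl (by decide) ⟨s₂.nv vbi, s₂.nv vbj, c, hc, ?_, ?_, ?_, ?_, ?_⟩
    · have : s₂.na asrv = s.na asrv := (f₂.na asrv rfl).trans (f₁.na asrv rfl)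
      simp_all [Cmd.run, NExp.eval]
    · simp_all [Cmd.run, NExp.eval]
    · have : s₂.na aR = s.na aR := (f₂.na aR rfl).trans eR
      simp_all [Cmd.run, NExp.eval]
    · have : s₂.na arem = s.na arem := (f₂.na arem rfl).trans erem
      simp_all [Cmd.run, NExp.eval]
    · have : s₂.nv vleft = s.nv vleft := (f₂.nv vleft rfl).trans (f₁.nv vleft rfl)
      simp_all [Cmd.run, NExp.eval]

theorem Problem.g_natCast {n m : ℕ} (A : Problem n m) (hat : ℕ → ℕ) (i : Fin n) (x : ℕ) :
    A.g (fun i => (hat i : ℝ)) i x = gval A.oracle hat i x := by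
  simp [Problem.g, gval, Problem.oracle]

/-- `Run` refers to the final `r` and `c` from its first step on, so the conclusion quantifies over
all `r`, `c` that agree with the final arrays. The first clause, that entries of threads outside `R`
no longer change, ensures that the entry written now is the one found at the end. -/
theorem exec_assignLoop {n m : ℕ} (A : Problem n m) (hm : 0 < m) (hat : ℕ → ℕ)
    (k : ℕ) (R : Finset (Fin n)) (s : Store) (hk : R.card = k) (hleft : s.nv vleft = k)
    (hn : s.nv vn = n) (hm' : s.nv vm = m) (hhat : s.na ahat = hat)
    (hR : ∀ i : Fin n, s.na aR i = 1 ↔ i ∈ R) :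
    Halts A.oracle (.loop (.nlt (.lit 0) (.var vleft)) assignStep) s (k * (300 * (n * m) + 4) + 4)
      (fun s' => (∀ i : Fin n, i ∉ R →
          s'.na asrv i = s.na asrv i ∧ s'.na aalloc i = s.na aalloc i) ∧
        (∀ i ∈ R, s'.na asrv i < m) ∧
        ∀ (r : Fin n → Fin m) (c : Fin n → ℝ),
          (∀ i, (r i : ℕ) = s'.na asrv i ∧ c i = s'.na aalloc i) →
          A.Run (fun i => (hat i : ℝ)) (fun j => (s.na arem j : ℝ)) R r c) := by
  induction k generalizing R s with
  | zero =>
    obtain rfl := card_eq_zero.1 hk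
    refine ⟨s, _, .loopFalse (by simp_all [BExp.Holds, NExp.eval]), by simp [BExp.cost, NExp.cost],
      fun _ _ => ⟨rfl, rfl⟩, by simp, fun r c _ => .done _ _ _⟩
  | succ k ih =>
    obtain ⟨i₀, hi₀⟩ := card_pos.1 (by omega : 0 < R.card)
    obtain ⟨s₁, t₁, e₁, ht₁, i, j, c, hch, h1, h2, h3, h4, h5⟩ := halts_assignStep (F := A.oracle)
      (s := s) ⟨i₀, by rw [hn]; exact i₀.2, (hR i₀).2 hi₀⟩ (by rw [hm']; exact hm)
    have hcle := hch.le
    rw [hn, hm'] at ht₁ hch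
    obtain ⟨⟨hi, hRi, hj⟩, hch⟩ := hch
    lift i to Fin n using hi
    lift j to Fin m using hj
    rw [hR] at hRi
    have f₁ := e₁.frame
    obtain ⟨s₂, t₂, e₂, ht₂, hold, hlt, hrun⟩ := ih (R.erase i) s₁
      (by rw [card_erase_of_mem hRi]; omega) (by omega) ((f₁.nv vn rfl).trans hn)
      ((f₁.nv vm rfl).trans hm') ((f₁.na ahat rfl).trans hhat) (by
        intro i'
        rw [h3, mem_erase, ← hR, Function.update_apply, ne_eq, ← Fin.val_inj]
        split_ifs with h <;> simp [h])
    obtain ⟨o1, o2⟩ := hold i (by simp)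
    rw [h1, Function.update_self] at o1
    rw [h2, Function.update_self] at o2
    refine ⟨s₂, _, .loopTrue (by simp [BExp.Holds, NExp.eval] at *; omega) e₁ e₂, ?_, ?_, ?_, ?_⟩
    · simp only [BExp.cost, NExp.cost]
      have : (k + 1) * (300 * (n * m) + 4) = k * (300 * (n * m) + 4) + (300 * (n * m) + 4) := by
        ring
      omega
    · intro i' hi'
      have hne : i' ≠ i := fun h => hi' (h ▸ hRi)
      have hne' : (i' : ℕ) ≠ i := fun h => hne (Fin.ext h)
      obtain ⟨g1, g2⟩ := hold i' (fun h => hi' (mem_of_mem_erase h))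
      rw [g1, g2, h1, h2, Function.update_of_ne hne', Function.update_of_ne hne']
      exact ⟨rfl, rfl⟩
    · intro i' hi'
      by_cases h : i' = i
      · subst h; rw [o1]; exact j.2
      · exact hlt i' (mem_erase.2 ⟨h, hi'⟩)
    · intro r c' hrc
      have hr : r i = j := Fin.ext ((hrc i).1.trans o1)
      have hc : c' i = c := by rw [(hrc i).2, o2]
      have hnext := hrun r c' hrc
      -- Truncated subtraction on the machine agrees with real subtraction because a choice never
      -- exceeds the remaining resource.
      have hrem : (fun j' : Fin m => (s₁.na arem j' : ℝ)) =
          Function.update (fun j' : Fin m => (s.na arem j' : ℝ)) j ((s.na arem j : ℝ) - c' i) := by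
        funext j'
        rw [h4, hc]
        by_cases h : j' = j
        · subst h; simp [Nat.cast_sub hcle]
        · rw [Function.update_of_ne h, Function.update_of_ne (fun h' => h (Fin.ext h'))]
      rw [hrem] at hnext
      rw [hhat] at hch
      rcases hch with ⟨hle, rfl, hmax⟩ | ⟨rfl, hU, hmax⟩
      · refine .full _ _ r c' i j ⟨hRi, by simpa using hle⟩ ?_ hc hr hnext
        rintro ⟨i', j'⟩ ⟨hi', hij'⟩
        rw [A.g_natCast, A.g_natCast]
        exact hmax i' j' i'.2 ((hR i').2 hi') j'.2 (by simpa using hij')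
      · refine .unfull _ _ r c' i j ?_ hRi ?_ hc hr hnext
        · ext ⟨i', j'⟩
          simp only [Problem.U, Set.mem_ofPred_eq, Set.mem_empty_iff_false, iff_false, not_and,
            not_le, Nat.cast_lt]
          exact fun hi' => hU i' j' i'.2 ((hR i').2 hi') j'.2
        · intro i' hi' j'
          rw [A.g_natCast, A.g_natCast]
          exact hmax i' j' i'.2 ((hR i').2 hi') j'.2

theorem halts_assignAlgorithm {n m C : ℕ} (A : Problem n m) (hn : 0 < n) (hm : 0 < m)
    (hC : A.C = C) (s : Store) (h1 : s.nv vn = n) (h2 : s.nv vm = m) (h3 : s.nv vC = C) :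
    Halts A.oracle assignAlgorithm s (400 * (n * n * m)) (fun s' =>
      ∃ (r : Fin n → Fin m) (c : Fin n → ℝ),
        (∀ i, (r i : ℕ) = s'.na asrv i ∧ c i = s'.na aalloc i) ∧
        A.IsOutput (fun i => (s.na ahat i : ℝ)) r c) := by
  have hnm : n ≤ n * m := Nat.le_mul_of_pos_right _ hm
  have hmn : m ≤ n * m := Nat.le_mul_of_pos_left _ hn
  have hnnm : n * m ≤ n * n * m := by
    rw [mul_assoc]; exact Nat.le_mul_of_pos_left _ hn
  refine Halts.seq (T₁ := m * (3 + 8) + 6) (T₂ := 300 * (n * n * m) + 4 * n + 4 + n * (3 + 8) + 10)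
    (halts_forLoop (T := 3) m (fun k s' => ∀ j < k, s'.na arem j = C)
      h2 rfl rfl (by simp) (by simp) ?_ le_rfl) ?_ (by omega)
  · intro k hk s' f hk' _ hI
    refine halts_of_loopFree rfl (by decide) ?_
    intro j hj
    have := f.nv vC rfl
    by_cases h : j = k
    · simp_all [Cmd.run, NExp.eval]
    · have := hI j (by omega)
      simp_all [Cmd.run, NExp.eval]
  intro s₁ f₁ hrem
  have n₁ : s₁.nv vn = n := (f₁.nv vn rfl).trans h1
  refine Halts.seq (T₁ := n * (3 + 8) + 6) (T₂ := 300 * (n * n * m) + 4 * n + 4 + 4)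
    (halts_forLoop (T := 3) n (fun k s' => ∀ j < k, s'.na aR j = 1)
      n₁ rfl rfl (by simp) (by simp) ?_ le_rfl) ?_ (by omega)
  · intro k hk s' f hk' _ hI
    refine halts_of_loopFree rfl (by decide) ?_
    intro j hj
    by_cases h : j = k
    · simp_all [Cmd.run, NExp.eval]
    · have := hI j (by omega)
      simp_all [Cmd.run, NExp.eval]
  intro s₂ f₂ hR
  have n₂ : s₂.nv vn = n := (f₂.nv vn rfl).trans n₁
  have m₂ : s₂.nv vm = m := (f₂.nv vm rfl).trans ((f₁.nv vm rfl).trans h2)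
  refine Halts.seq (T₁ := 2) (T₂ := 300 * (n * n * m) + 4 * n + 4)
    (P := fun s' => s' = s₂.setN vleft n)
    (halts_of_loopFree rfl (by decide) (by simp_all [Cmd.run, NExp.eval])) ?_ (by omega)
  rintro _ - rfl
  refine (exec_assignLoop A hm (s.na ahat) n univ (s₂.setN vleft n) (by simp) (by simp)
    (by simpa using n₂) (by simpa using m₂) ?_ ?_).mono ?_ ?_
  · exact (f₂.na ahat rfl).trans (f₁.na ahat rfl)
  · intro i
    simpa using hR i i.2
  · have : n * (300 * (n * m) + 4) = 300 * (n * n * m) + 4 * n := by ring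
    omega
  · rintro s' - ⟨-, hlt, hrun⟩
    refine ⟨fun i => ⟨s'.na asrv i, hlt i (mem_univ i)⟩, fun i => s'.na aalloc i,
      fun i => ⟨rfl, rfl⟩, ?_⟩
    have := hrun (fun i => ⟨s'.na asrv i, hlt i (mem_univ i)⟩) (fun i => s'.na aalloc i)
      fun i => ⟨rfl, rfl⟩
    unfold Problem.IsOutput
    convert this using 2 with j
    have hj : s₂.na arem j = C := by
      rw [f₂.na arem rfl]; exact hrem j j.2
    simp at hj
    simp [hC, hj]

end AA

end

noncomputable section

namespace AA

/-! ## Separable concave maximization over the naturals -/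

/-- `x` maximizes `∑ i < n, G i (x i)` among the vectors of naturals with sum `B`. -/
def IsOptimal (G : ℕ → ℕ → ℝ) (n B : ℕ) (x : ℕ → ℕ) : Prop :=
  ∑ i ∈ range n, x i = B ∧
    ∀ y : ℕ → ℕ, ∑ i ∈ range n, y i = B →
      ∑ i ∈ range n, G i (y i) ≤ ∑ i ∈ range n, G i (x i)

/-- The gain from one more unit for thread `i`. -/
def gain (G : ℕ → ℕ → ℝ) (i k : ℕ) : ℝ := G i (k + 1) - G i k

variable {G : ℕ → ℕ → ℝ} {n B : ℕ} {x l u : ℕ → ℕ}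

/-- Entries from `n` on are irrelevant; setting them to zero puts every competitor into the finite
set `piAntidiag`. -/
theorem exists_isOptimal (G : ℕ → ℕ → ℝ) (hn : 0 < n) (B : ℕ) : ∃ x, IsOptimal G n B x := by
  obtain ⟨x, hx, hmax⟩ := exists_max_image ((range n).piAntidiag B)
    (fun y => ∑ i ∈ range n, G i (y i)) ⟨fun i => if i = 0 then B else 0,
      mem_piAntidiag.2 ⟨by simp [hn.ne'], fun i hi => by simp_all⟩⟩
  refine ⟨x, (mem_piAntidiag.1 hx).1, fun y hy => ?_⟩
  have h : ∀ g : ℕ → ℕ → ℝ, ∑ i ∈ range n, g i (if i < n then y i else 0) =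
      ∑ i ∈ range n, g i (y i) := fun g =>
    sum_congr rfl fun i hi => by rw [if_pos (mem_range.1 hi)]
  have := hmax (fun i => if i < n then y i else 0) (mem_piAntidiag.2 ⟨?_, ?_⟩)
  · rwa [h] at this
  · rw [← hy]
    exact sum_congr rfl fun i hi => by rw [if_pos (mem_range.1 hi)]
  · intro i hi
    by_contra hc
    simp_all

theorem sum_range_update {M : Type*} [AddCommGroup M] (g : ℕ → ℕ → M) (x : ℕ → ℕ) {i : ℕ}
    (hi : i < n) (v : ℕ) : ∑ k ∈ range n, g k (Function.update x i v k) =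
      ∑ k ∈ range n, g k (x k) + (g i v - g i (x i)) := by
  have hi' := mem_range.2 hi
  rw [← add_sum_erase _ _ hi', ← add_sum_erase _ (fun k => g k (x k)) hi']
  rw [sum_congr rfl (g := fun k => g k (x k)) fun k hk => by
    rw [Function.update_of_ne (ne_of_mem_erase hk)]]
  simp only [Function.update_self]
  abel

/-- Moving one unit from `j` to `i`. -/
theorem sum_exchange {M : Type*} [AddCommGroup M] (g : ℕ → ℕ → M) (x : ℕ → ℕ) {i j : ℕ}
    (hi : i < n) (hj : j < n) (hij : i ≠ j) :
    ∑ k ∈ range n, g k (Function.update (Function.update x i (x i + 1)) j (x j - 1) k) =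
      ∑ k ∈ range n, g k (x k) + (g i (x i + 1) - g i (x i)) + (g j (x j - 1) - g j (x j)) := by
  rw [sum_range_update g _ hj, sum_range_update g x hi, Function.update_of_ne hij.symm]

theorem sum_exchange_eq (x : ℕ → ℕ) {i j : ℕ} (hi : i < n) (hj : j < n) (hij : i ≠ j)
    (hxj : 0 < x j) :
    ∑ k ∈ range n, Function.update (Function.update x i (x i + 1)) j (x j - 1) k =
      ∑ k ∈ range n, x k := by
  have := sum_exchange (n := n) (fun _ k => (k : ℤ)) x hi hj hij
  push_cast [Nat.cast_sub (show 1 ≤ x j from hxj)] at this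
  zify
  rw [this]
  ring

/-- Otherwise moving one unit from `j` to `i` would increase the total. -/
theorem IsOptimal.gain_le (hx : IsOptimal G n B x) {i j : ℕ} (hi : i < n) (hj : j < n)
    (hij : i ≠ j) (hxj : 0 < x j) : gain G i (x i) ≤ gain G j (x j - 1) := by
  have h := hx.2 _ ((sum_exchange_eq x hi hj hij hxj).trans hx.1)
  rw [sum_exchange G x hi hj hij] at h
  unfold gain
  rw [Nat.sub_add_cancel hxj]
  linarith

theorem IsOptimal.exchange (hx : IsOptimal G n B x) {i j : ℕ} (hi : i < n) (hj : j < n)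
    (hij : i ≠ j) (hxj : 0 < x j) (h : gain G j (x j - 1) ≤ gain G i (x i)) :
    IsOptimal G n B (Function.update (Function.update x i (x i + 1)) j (x j - 1)) := by
  refine ⟨(sum_exchange_eq x hi hj hij hxj).trans hx.1, fun y hy => (hx.2 y hy).trans ?_⟩
  rw [sum_exchange G x hi hj hij]
  unfold gain at h
  rw [Nat.sub_add_cancel hxj] at h
  linarith

/-- If all units between `l` and `u ≤ x` are worth at least as much as every unit above `x`, then
a lower bound `l` for some optimal vector can be raised to `u`. -/
theorem exists_isOptimal_ge (hG : ∀ i < n, Antitone (gain G i)) (hxB : ∑ i ∈ range n, x i ≤ B)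
    (hux : ∀ i < n, u i ≤ x i)
    (hgain : ∀ i < n, ∀ k, l i ≤ k → k < u i → ∀ j < n, gain G j (x j) ≤ gain G i k)
    (hl : ∃ z, IsOptimal G n B z ∧ ∀ i < n, l i ≤ z i) :
    ∃ z, IsOptimal G n B z ∧ ∀ i < n, u i ≤ z i := by
  -- Induction on the total deficit of `z` below `u`. The bound kept is `min (l i) (u i)`, because
  -- an exchange may bring an entry below `l`, but never below `u`.
  suffices h : ∀ d, ∀ z, IsOptimal G n B z → (∀ i < n, min (l i) (u i) ≤ z i) →
      ∑ i ∈ range n, (u i - z i) = d → ∃ z, IsOptimal G n B z ∧ ∀ i < n, u i ≤ z i by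
    obtain ⟨z, hz, hlz⟩ := hl
    exact h _ z hz (fun i hi => (min_le_left _ _).trans (hlz i hi)) rfl
  intro d
  induction d using Nat.strong_induction_on with
  | _ d ih =>
  intro z hz hlz hd
  by_cases hall : ∀ i < n, u i ≤ z i
  · exact ⟨z, hz, hall⟩
  push Not at hall
  obtain ⟨i, hi, hiu⟩ := hall
  -- The sum of `z` is `B`, at least that of `x`, while `z i < x i`; so `z` exceeds `x` somewhere
  -- else.
  obtain ⟨j, hj, hjx⟩ : ∃ j < n, x j < z j := by
    by_contra! hc
    have : ∑ k ∈ range n, z k < ∑ k ∈ range n, x k :=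
      sum_lt_sum (fun k hk => hc k (mem_range.1 hk))
        ⟨i, mem_range.2 hi, hiu.trans_le (hux i hi)⟩
    rw [hz.1] at this
    omega
  have hij : i ≠ j := by
    rintro rfl
    have := hux i hi
    omega
  have hli : l i ≤ z i := by
    have := hlz i hi
    rcases min_le_iff.1 this with h | h <;> omega
  -- The unit taken from `j` lies above `x j`, and the one given to `i` lies between `l i` and `u
  -- i`, so the exchange loses nothing.
  have hg : gain G j (z j - 1) ≤ gain G i (z i) :=
    (hG j hj (by omega : x j ≤ z j - 1)).trans (hgain i hi (z i) hli hiu j hj)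
  refine ih _ ?_ _ (hz.exchange hi hj hij (by omega) hg) ?_ rfl
  · rw [← hd]
    refine sum_lt_sum (fun k hk => ?_) ⟨i, mem_range.2 hi, ?_⟩
    · have := hux j hj
      rw [Function.update_apply, Function.update_apply]
      split_ifs with h1 h2
      · subst h1; omega
      · subst h2; omega
      · rfl
    · rw [Function.update_of_ne hij, Function.update_self]
      omega
  · intro k hk
    have h0 := hlz k hk
    have := hux k hk
    rw [Function.update_apply, Function.update_apply]
    split_ifs with h1 h2
    · subst h1
      exact (min_le_right _ _).trans (by omega)
    · subst h2; omega
    · exact h0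

/-! ### Greedy steps of size `d` and their partial return -/

/-- The state of the greedy algorithm with step `d`, started from `l`. -/
def GreedyInv (G : ℕ → ℕ → ℝ) (n d : ℕ) (l x : ℕ → ℕ) : Prop :=
  ∀ i < n, x i = l i ∨ (l i + d ≤ x i ∧ ∀ j < n, gain G j (x j) ≤ gain G i (x i - d))

/-- Gains only fall as the vector grows, so the inequalities of the other threads persist; for `i`,
the required one is the maximality of the choice. -/
theorem GreedyInv.step (hG : ∀ i < n, Antitone (gain G i)) {d : ℕ} (h : GreedyInv G n d l x)
    {i : ℕ} (hi : i < n) (hmax : ∀ j < n, gain G j (x j) ≤ gain G i (x i)) :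
    GreedyInv G n d l (Function.update x i (x i + d)) := by
  have hle : ∀ j < n, gain G j (Function.update x i (x i + d) j) ≤ gain G j (x j) := by
    intro j hj
    apply hG j hj
    rw [Function.update_apply]
    split_ifs with h
    · subst h; omega
    · rfl
  intro k hk
  by_cases hki : k = i
  · subst hki
    right
    rw [Function.update_self]
    refine ⟨?_, fun j hj => ?_⟩
    · rcases h k hk with h | h <;> omega
    · rw [Nat.add_sub_cancel]
      exact (hle j hj).trans (hmax j hj)
  · rw [Function.update_of_ne hki]
    exact (h k hk).imp_right fun h => ⟨h.1, fun j hj => (hle j hj).trans (h.2 j hj)⟩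

/-- All but one unit of the last step are taken back. -/
theorem GreedyInv.exists_isOptimal (hG : ∀ i < n, Antitone (gain G i)) {d : ℕ} (hd : 0 < d)
    (h : GreedyInv G n d l x) (hxB : ∑ i ∈ range n, x i ≤ B)
    (hl : ∃ z, IsOptimal G n B z ∧ ∀ i < n, l i ≤ z i) :
    ∃ z, IsOptimal G n B z ∧ ∀ i < n, (if l i < x i then x i - (d - 1) else x i) ≤ z i := by
  refine exists_isOptimal_ge hG hxB (fun i _ => by split_ifs <;> omega) ?_ hl
  intro i hi k hlk hku j hj
  rcases h i hi with h | ⟨h1, h2⟩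
  · split_ifs at hku <;> omega
  · rw [if_pos (by omega)] at hku
    -- Here `k < x i - (d - 1)` means `k ≤ x i - d`, so unit `k` gains at least as much as the first
    -- unit of the last step.
    exact (h2 j hj).trans (hG i hi (by omega))

theorem IsOptimal.congr {y : ℕ → ℕ} (h : IsOptimal G n B x) (hy : ∀ i < n, y i = x i) :
    IsOptimal G n B y := by
  refine ⟨(sum_congr rfl fun i hi => hy i (mem_range.1 hi)).trans h.1, fun z hz => ?_⟩
  refine (h.2 z hz).trans_eq (sum_congr rfl fun i hi => ?_)
  rw [hy i (mem_range.1 hi)]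

theorem isOptimal_of_sum_eq (hx : ∑ i ∈ range n, x i = B)
    (h : ∃ z, IsOptimal G n B z ∧ ∀ i < n, x i ≤ z i) : IsOptimal G n B x := by
  obtain ⟨z, hz, hxz⟩ := h
  have := (sum_eq_sum_iff_of_le fun i hi => hxz i (mem_range.1 hi)).1 (hx.trans hz.1.symm)
  exact hz.congr fun i hi => this i (mem_range.2 hi)

/-- An optimal vector maximizes a Lagrangian. -/
theorem IsOptimal.exists_multiplier (hG : ∀ i < n, Antitone (gain G i))
    (hmono : ∀ i < n, Monotone (G i)) (hn : 0 < n) (hx : IsOptimal G n B x) :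
    ∃ c : ℝ, 0 ≤ c ∧ ∀ i < n, ∀ y : ℕ, G i y ≤ G i (x i) + c * ((y : ℝ) - x i) := by
  obtain ⟨j, hj, hmax⟩ := exists_max_image (range n) (fun j => gain G j (x j))
    ⟨0, mem_range.2 hn⟩
  rw [mem_range] at hj
  -- The multiplier is the largest gain from a next unit. Going up from `x i`, each unit gains at
  -- most this; going down, each unit lost was worth at least this.
  refine ⟨gain G j (x j), sub_nonneg.2 (hmono j hj (by omega)), fun i hi y => ?_⟩
  have hup : ∀ k, G i (x i + k) ≤ G i (x i) + gain G j (x j) * k := by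
    intro k
    induction k with
    | zero => simp
    | succ k ih =>
      have h1 : gain G i (x i + k) ≤ gain G i (x i) := hG i hi (by omega)
      have h2 := hmax i (mem_range.2 hi)
      have h3 : gain G i (x i + k) = G i (x i + (k + 1)) - G i (x i + k) := rfl
      push_cast
      linarith
  have hdown : ∀ k ≤ x i, G i (x i - k) ≤ G i (x i) - gain G j (x j) * k := by
    intro k
    induction k with
    | zero => simp
    | succ k ih =>
      intro hk
      have h1 : gain G j (x j) ≤ gain G i (x i - (k + 1)) := by
        by_cases hij : j = i
        · subst hij
          exact hG j hj (by omega)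
        · exact (hx.gain_le hj hi hij (by omega)).trans (hG i hi (by omega))
      have h3 : gain G i (x i - (k + 1)) = G i (x i - k) - G i (x i - (k + 1)) := by
        unfold gain
        rw [show x i - (k + 1) + 1 = x i - k by omega]
      have := ih (by omega)
      push_cast
      linarith
  rcases le_total (x i) y with h | h
  · have := hup (y - x i)
    rwa [Nat.add_sub_cancel' h, Nat.cast_sub h] at this
  · have := hdown (x i - y) (by omega)
    rw [Nat.sub_sub_self h, Nat.cast_sub h] at this
    linarith

/-! ## Optimal vectors and super-optimal allocations -/

namespace Problem

variable {m : ℕ} (A : Problem n m) (C : ℕ)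

/-- The utility functions at whole numbers of units, extended by constants. -/
def capped (i k : ℕ) : ℝ := A.oracle i (min k C)

variable {A C}

theorem monotone_capped (hC : A.C = C) {i : ℕ} (hi : i < n) : Monotone (A.capped C i) := by
  intro k k' hk
  simp only [capped, oracle, dif_pos hi]
  have h : ∀ k : ℕ, ((min k C : ℕ) : ℝ) ∈ Set.Icc 0 A.C := fun k =>
    ⟨by positivity, by rw [hC]; exact_mod_cast min_le_right _ _⟩
  exact A.mono _ (h k) (h k') (by exact_mod_cast min_le_min_right C hk)

/-- Below the cap this is midpoint concavity at `k` and `k + 2`; from the cap on the later gain is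
zero and the earlier one is nonnegative. -/
theorem antitone_gain_capped (hC : A.C = C) {i : ℕ} (hi : i < n) :
    Antitone (gain (A.capped C) i) := by
  refine antitone_nat_of_succ_le fun k => ?_
  have hm := A.monotone_capped hC hi
  by_cases hk : C ≤ k + 1
  · have h : A.capped C i (k + 1 + 1) = A.capped C i (k + 1) := by
      simp only [capped]
      rw [min_eq_right hk, min_eq_right (by omega)]
    have : gain (A.capped C) i (k + 1) = 0 := by
      unfold gain; rw [h, sub_self]
    rw [this]
    exact sub_nonneg.2 (hm (by omega))
  · have h : ∀ k' ≤ k + 2, A.capped C i k' = A.f ⟨i, hi⟩ k' := by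
      intro k' hk'
      simp only [capped, oracle, dif_pos hi]
      rw [min_eq_left (by omega)]
    have hmem : ∀ k' ≤ k + 2, (k' : ℝ) ∈ Set.Icc 0 A.C := fun k' hk' =>
      ⟨by positivity, by rw [hC]; exact_mod_cast (by omega : k' ≤ C)⟩
    have := (A.concave ⟨i, hi⟩).2 (hmem k (by omega)) (hmem (k + 2) le_rfl)
      (by norm_num : (0 : ℝ) ≤ 1 / 2) (by norm_num : (0 : ℝ) ≤ 1 / 2) (by norm_num)
    have he : (1 / 2 : ℝ) • (k : ℝ) + (1 / 2 : ℝ) • ((k + 2 : ℕ) : ℝ) = ((k + 1 : ℕ) : ℝ) := by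
      push_cast; simp only [smul_eq_mul]; ring
    rw [he] at this
    simp only [smul_eq_mul] at this
    unfold gain
    rw [h (k + 1 + 1) (by omega), h (k + 1) (by omega), h k (by omega)]
    linarith

theorem capped_eq (i : Fin n) {k : ℕ} (hk : k ≤ C) : A.capped C i k = A.f i k := by
  simp [capped, oracle, min_eq_left hk]

/-- The truncation of an optimal vector maximizes the total utility over every set of pooled
allocations on which the utility functions satisfy the bound given by a multiplier. -/
theorem isMaxOn_of_multiplier (hC : A.C = C) {x : ℕ → ℕ}
    (hx : ∑ i ∈ range n, x i = m * C) {c : ℝ} (hc : 0 ≤ c) {S : Set (Fin n → ℝ)}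
    (hS : S ⊆ A.Pooled)
    (h : ∀ y ∈ S, ∀ i : Fin n, A.f i (y i) ≤ A.capped C i (x i) + c * (y i - x i)) :
    IsMaxOn (fun c => ∑ i, A.f i (c i)) S (fun i => ((min (x i) C : ℕ) : ℝ)) := by
  intro y hy
  have hsum : ∑ i : Fin n, (x i : ℝ) = m * A.C := by
    rw [hC, Fin.sum_univ_eq_sum_range (fun i => (x i : ℝ))]
    exact_mod_cast hx
  have hval : ∀ i : Fin n, A.f i ((min (x i) C : ℕ) : ℝ) = A.capped C i (x i) := fun i => by
    simp [capped, oracle]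
  have h1 : ∑ i, A.f i (y i) ≤ ∑ i : Fin n, (A.capped C i (x i) + c * (y i - x i)) :=
    sum_le_sum fun i _ => h y hy i
  rw [sum_add_distrib, ← mul_sum, sum_sub_distrib, hsum] at h1
  -- Since `x` uses exactly `m * C` and `y` at most that, the terms with `c` sum to at most zero.
  have h2 := mul_nonneg hc (sub_nonneg.2 (hS hy).2)
  simp only [Set.mem_ofPred_eq, hval]
  linarith

theorem truncate_mem (hC : A.C = C) {x : ℕ → ℕ} (hx : ∑ i ∈ range n, x i = m * C) :
    (fun i : Fin n => ((min (x i) C : ℕ) : ℝ)) ∈ A.Pooled := by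
  refine ⟨fun i => ⟨Nat.cast_nonneg _, by
    rw [hC]; exact Nat.cast_le.2 (min_le_right _ _)⟩, ?_⟩
  rw [hC, Fin.sum_univ_eq_sum_range (fun i => ((min (x i) C : ℕ) : ℝ))]
  have : ∑ i ∈ range n, min (x i) C ≤ m * C := hx ▸ sum_le_sum fun i _ => min_le_left _ _
  exact_mod_cast this

theorem isUnitSuperOptimal_truncate (hC : A.C = C) (hn : 0 < n) {x : ℕ → ℕ}
    (hx : IsOptimal (A.capped C) n (m * C) x) :
    A.IsUnitSuperOptimal (fun i => ((min (x i) C : ℕ) : ℝ)) := by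
  obtain ⟨c, hc, h⟩ := hx.exists_multiplier (fun i hi => A.antitone_gain_capped hC hi)
    (fun i hi => A.monotone_capped hC hi) hn
  refine ⟨⟨truncate_mem hC hx.1, fun i => ⟨_, rfl⟩⟩,
    isMaxOn_of_multiplier hC hx.1 hc Set.inter_subset_left ?_⟩
  rintro y ⟨⟨hy, -⟩, hyn⟩ i
  obtain ⟨k, hk⟩ := hyn i
  have := h i i.2 k
  rw [capped_eq i] at this
  · rwa [hk]
  · have := (hy i).2
    rw [hk, hC] at this
    exact_mod_cast this

/-- The multiplier bound is affine in the allocation, so its instances at two consecutive integers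
interpolate to every real point between them. -/
theorem isSuperOptimal_truncate (hC : A.C = C) (hn : 0 < n) (hA : A.AffineBetweenUnits) {x : ℕ → ℕ}
    (hx : IsOptimal (A.capped C) n (m * C) x) :
    A.IsSuperOptimal (fun i => ((min (x i) C : ℕ) : ℝ)) := by
  obtain ⟨c, hc, h⟩ := hx.exists_multiplier (fun i hi => A.antitone_gain_capped hC hi)
    (fun i hi => A.monotone_capped hC hi) hn
  refine ⟨truncate_mem hC hx.1, isMaxOn_of_multiplier hC hx.1 hc subset_rfl ?_⟩
  rintro y ⟨hy, -⟩ i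
  obtain ⟨h0, hyC⟩ := hy i
  rw [hC] at hyC
  have hle := Nat.floor_le h0
  have hlt := Nat.lt_floor_add_one (y i)
  set k := ⌊y i⌋₊
  rcases hyC.lt_or_eq with hyC | hyC
  · have hk : k + 1 ≤ C := by
      have : (k : ℝ) < C := hle.trans_lt hyC
      exact_mod_cast this
    have h1 := h i i.2 k
    have h2 := h i i.2 (k + 1)
    rw [capped_eq i (by omega)] at h1
    rw [capped_eq i hk] at h2
    have h3 := hA i k (by rw [hC]; exact_mod_cast hk) (y i - k) ⟨by linarith, by linarith⟩
    rw [add_sub_cancel] at h3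
    push_cast at h2
    rw [h3]
    have h4 := mul_le_mul_of_nonneg_left h1 (by linarith : 0 ≤ 1 - (y i - k))
    have h5 := mul_le_mul_of_nonneg_left h2 (by linarith : 0 ≤ y i - k)
    linarith
  -- At `y i = C` there is no unit interval to the right inside the domain, and the integer bound
  -- applies directly.
  · have := h i i.2 C
    rwa [capped_eq i le_rfl, ← hyC] at this

end Problem

end AA

end

noncomputable section

namespace AA

/-! ## Computing a super-optimal allocation -/

/-- Natural variables: the resource not yet allocated, the step of the greedy algorithm, and a node
of the tournament tree. -/
abbrev vfree : ℕ := 12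
abbrev vstep : ℕ := 13
abbrev vnode : ℕ := 14
/-- Natural arrays: the allocation before the current phase, and the winners at the nodes of the
tournament tree, whose root is `1` and whose leaves are `n, …, 2 * n - 1`. -/
abbrev alow : ℕ := 7
abbrev atree : ℕ := 8
/-- Real array: the gains from one more unit. -/
abbrev akey : ℕ := 0

/-- `min e C` -/
def capExp (e : NExp) : NExp := .sub e (.sub e (.var vC))

def updateKey : Cmd :=
  .putR akey (.var vi)
    (.sub (.util (.var vi) (capExp (.add (.cell ahat (.var vi)) (.lit 1))))
      (.util (.var vi) (capExp (.cell ahat (.var vi)))))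

/-- Recompute the winner at a node from the winners at its children. -/
def pull : Cmd :=
  .ite (.rlt (.cell akey (.cell atree (.add (.var vnode) (.var vnode))))
      (.cell akey (.cell atree (.add (.add (.var vnode) (.var vnode)) (.lit 1)))))
    (.putN atree (.var vnode) (.cell atree (.add (.add (.var vnode) (.var vnode)) (.lit 1))))
    (.putN atree (.var vnode) (.cell atree (.add (.var vnode) (.var vnode))))

/-- Descending order processes both children of a node before the node. -/
def buildTree : Cmd :=
  .setN vnode (.sub (.var vn) (.lit 1)) ;;
  .loop (.nlt (.lit 0) (.var vnode)) (pull ;; .setN vnode (.sub (.var vnode) (.lit 1)))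

def updateTree : Cmd :=
  .setN vnode (.half (.add (.var vn) (.var vi))) ;;
  .loop (.nlt (.lit 0) (.var vnode)) (pull ;; .setN vnode (.half (.var vnode)))

def startPhase : Cmd :=
  forLoop vi vn
    (.putN alow (.var vi) (.cell ahat (.var vi)) ;; updateKey ;;
      .putN atree (.add (.var vn) (.var vi)) (.var vi))

def greedyStep : Cmd :=
  .setN vi (.cell atree (.lit 1)) ;;
  .putN ahat (.var vi) (.add (.cell ahat (.var vi)) (.var vstep)) ;;
  .setN vfree (.sub (.var vfree) (.var vstep)) ;;
  updateKey ;; updateTree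

def endPhase : Cmd :=
  forLoop vi vn
    (.ite (.nlt (.cell alow (.var vi)) (.cell ahat (.var vi)))
      (.setN vfree (.add (.var vfree) (.sub (.var vstep) (.lit 1))) ;;
        .putN ahat (.var vi) (.sub (.cell ahat (.var vi)) (.sub (.var vstep) (.lit 1))))
      .skip)

/-- The greedy algorithm with a given step, with all but one unit of the last step of every thread
taken back. -/
def phase : Cmd :=
  startPhase ;; buildTree ;; .loop (.not (.nlt (.var vfree) (.var vstep))) greedyStep ;; endPhase

def superOptAlgorithm : Cmd :=
  forLoop vj vm (.setN vfree (.add (.var vfree) (.var vC))) ;;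
  .setN vstep (.lit 1) ;;
  .loop (.not (.nlt (.var vfree) (.var vstep))) (.setN vstep (.add (.var vstep) (.var vstep))) ;;
  .loop (.nlt (.lit 0) (.var vstep)) (phase ;; .setN vstep (.half (.var vstep))) ;;
  forLoop vi vn (.putN ahat (.var vi) (capExp (.cell ahat (.var vi))))

attribute [local simp] vn vm vC vi vj ahat vfree vstep vnode alow atree akey

variable {F : ℕ → ℕ → ℝ} {s : Store}

/-! The tournament tree -/

/-- The winner at a node is as good as those at its children. -/
def WinsAt (key : ℕ → ℝ) (t : ℕ → ℕ) (v : ℕ) : Prop :=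
  key (t (2 * v)) ≤ key (t v) ∧ key (t (2 * v + 1)) ≤ key (t v)

/-- The winner at a node is a leaf below it. -/
def WinnerBelow (n : ℕ) (t : ℕ → ℕ) (v : ℕ) : Prop :=
  t v < n ∧ ∃ k, v = (n + t v) / 2 ^ k

/-- `below` localizes updates: a thread can win only at ancestors of its own leaf, so a changed key
can spoil `wins` only there. -/
structure IsTournament (n : ℕ) (key : ℕ → ℝ) (t : ℕ → ℕ) : Prop where
  leaf : ∀ i < n, t (n + i) = i
  below : ∀ v, 0 < v → v < 2 * n → WinnerBelow n t v
  wins : ∀ v, 0 < v → v < n → WinsAt key t v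

theorem IsTournament.key_le {n : ℕ} {key : ℕ → ℝ} {t : ℕ → ℕ} (h : IsTournament n key t) {i : ℕ}
    (hi : i < n) : key i ≤ key (t 1) := by
  have : ∀ v, 0 < v → v < 2 * n → key (t v) ≤ key (t 1) := by
    intro v
    induction v using Nat.strong_induction_on with
    | _ v ih =>
    intro h0 hv
    rcases Nat.lt_or_ge 1 v with h1 | h1
    · have hw := h.wins (v / 2) (by omega) (by omega)
      have := ih (v / 2) (by omega) (by omega) (by omega)
      rcases Nat.mod_two_eq_zero_or_one v with h2 | h2
      · rw [show v = 2 * (v / 2) by omega]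
        exact hw.1.trans this
      · rw [show v = 2 * (v / 2) + 1 by omega]
        exact hw.2.trans this
    · rw [show v = 1 by omega]
  have h' := this (n + i) (by omega) (by omega)
  rwa [h.leaf i hi] at h'

theorem WinnerBelow.update {n : ℕ} {t : ℕ → ℕ} {v c w : ℕ} (h : WinnerBelow n t c)
    (hc : c = 2 * v ∨ c = 2 * v + 1) (hw : w ≠ v → WinnerBelow n t w) :
    WinnerBelow n (Function.update t v (t c)) w := by
  by_cases hwv : w = v
  · subst hwv
    obtain ⟨h1, k, hk⟩ := h
    refine ⟨by simpa using h1, k + 1, ?_⟩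
    rw [Function.update_self, pow_succ, ← Nat.div_div_eq_div_mul, ← hk]
    omega
  · unfold WinnerBelow
    rw [Function.update_of_ne hwv]
    exact hw hwv

/-- The entry at `v` enters only the conditions at `v` and at its parent `v / 2`. -/
theorem WinsAt.update {key : ℕ → ℝ} {t : ℕ → ℕ} {v x w : ℕ} (h : WinsAt key t w) (hw : w ≠ v)
    (hwv : w ≠ v / 2) : WinsAt key (Function.update t v x) w := by
  unfold WinsAt
  rw [Function.update_of_ne hw, Function.update_of_ne (by omega), Function.update_of_ne (by omega)]
  exact h

theorem halts_pull (hv : 0 < s.nv vnode) :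
    Halts F pull s 40 (fun s' => ∃ c, (c = 2 * s.nv vnode ∨ c = 2 * s.nv vnode + 1) ∧
      s'.na atree = Function.update (s.na atree) (s.nv vnode) (s.na atree c) ∧
      WinsAt (s.ra akey) (s'.na atree) (s.nv vnode)) := by
  have h2 : s.nv vnode + s.nv vnode = 2 * s.nv vnode := by ring
  refine halts_of_loopFree rfl (by decide) ?_
  by_cases hlt : s.ra akey (s.na atree (2 * s.nv vnode)) <
      s.ra akey (s.na atree (2 * s.nv vnode + 1))
  · have he : (pull.run F s).na atree = Function.update (s.na atree) (s.nv vnode)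
        (s.na atree (2 * s.nv vnode + 1)) := by
      simp_all [pull, Cmd.run, BExp.Holds, NExp.eval, RExp.eval]
    refine ⟨_, .inr rfl, he, ?_⟩
    rw [he]
    unfold WinsAt
    rw [Function.update_self, Function.update_of_ne (by omega), Function.update_of_ne (by omega)]
    exact ⟨hlt.le, le_rfl⟩
  · have he : (pull.run F s).na atree = Function.update (s.na atree) (s.nv vnode)
        (s.na atree (2 * s.nv vnode)) := by
      simp_all [pull, Cmd.run, BExp.Holds, NExp.eval, RExp.eval, not_lt_of_ge]
    refine ⟨_, .inl rfl, he, ?_⟩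
    rw [he]
    unfold WinsAt
    rw [Function.update_self, Function.update_of_ne (by omega), Function.update_of_ne (by omega)]
    exact ⟨le_rfl, not_lt.1 hlt⟩

theorem halts_buildTree {n : ℕ} (hn : s.nv vn = n) (hn0 : 0 < n)
    (hleaf : ∀ i < n, s.na atree (n + i) = i) :
    Halts F buildTree s (n * 48 + 8)
      (fun s' => IsTournament n (s.ra akey) (s'.na atree)) := by
  refine Halts.seq (T₁ := 4) (T₂ := n * 48 + 4) (P := fun s' => s' = s.setN vnode (n - 1))
    (halts_of_loopFree rfl (by decide) (by simp_all [Cmd.run, NExp.eval])) ?_ (by omega)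
  rintro _ - rfl
  refine (halts_loop (T := 44) (T₁ := n * 48 + 4) (fun k s' => s'.nv vnode = k ∧ k < n ∧
      (∀ i < n, s'.na atree (n + i) = i) ∧
      (∀ v, k < v → v < 2 * n → WinnerBelow n (s'.na atree) v) ∧
      (∀ v, k < v → v < n → WinsAt (s.ra akey) (s'.na atree) v)) ?_ (n - 1) ?_ ?_).mono le_rfl ?_
  · rintro k s₁ f₁ ⟨hk, hkn, hl, hb, hw⟩ hlt
    have hlt : 0 < k := by simpa [BExp.Holds, NExp.eval, ← hk] using hlt
    refine ⟨k - 1, by omega, ?_⟩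
    refine Halts.seq (T₁ := 40) (T₂ := 4) (halts_pull (by omega)) ?_ le_rfl
    rintro s₂ f₂ ⟨c, hc, he, hwk⟩
    have hkey : s₁.ra akey = s.ra akey := f₁.ra akey rfl
    have hnode : s₂.nv vnode = k := (f₂.nv vnode rfl).trans hk
    rw [hk] at hc he hwk
    rw [hkey, he] at hwk
    refine halts_of_loopFree rfl (by decide) ?_
    have hr : Cmd.run F (.setN vnode (.sub (.var vnode) (.lit 1))) s₂ = s₂.setN vnode (k - 1) := by
      simp_all [Cmd.run, NExp.eval]
    rw [hr, Store.na_setN, he]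
    refine ⟨by simp, by omega, fun i hi => ?_, fun v hv hvn => ?_, fun v hv hvn => ?_⟩
    · rw [Function.update_of_ne (by omega)]
      exact hl i hi
    · exact (hb c (by omega) (by omega)).update hc fun h => hb v (by omega) hvn
    · by_cases h : v = k
      · rw [h]; exact hwk
      · exact (hw v (by omega) hvn).update h (by omega)
  · refine ⟨by simp, by omega, by simpa using hleaf, fun v hv hvn => ?_, fun v hv hvn => by omega⟩
    obtain ⟨i, rfl⟩ := Nat.exists_eq_add_of_le (by omega : n ≤ v)
    have := hleaf i (by omega)
    unfold WinnerBelow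
    rw [Store.na_setN, this]
    exact ⟨by omega, 0, by simp⟩
  · simp only [BExp.cost, NExp.cost]; omega
  · rintro s' - ⟨⟨k, hk, -, hl, hb, hw⟩, hlt⟩
    obtain rfl : k = 0 := by simpa [BExp.Holds, NExp.eval, ← hk] using hlt
    exact ⟨hl, hb, hw⟩

/-- The invariant exempts exactly the current node and its ancestors `vnode / 2 ^ k`. At `vnode = 0`
no positive node is exempt. The path starts below `n ≤ 2 ^ b`, so it has at most `b` nodes. -/
theorem halts_updateTree {n b : ℕ} {key : ℕ → ℝ} (hn : s.nv vn = n) (hi : s.nv vi < n)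
    (hb : n ≤ 2 ^ b) (h : IsTournament n key (s.na atree))
    (hkey : ∀ i ≠ s.nv vi, s.ra akey i = key i) :
    Halts F updateTree s (b * 47 + 10)
      (fun s' => IsTournament n (s.ra akey) (s'.na atree)) := by
  generalize hi' : s.nv vi = i at *
  refine Halts.seq (T₁ := 5) (T₂ := b * 47 + 4) (P := fun s' => s' = s.setN vnode ((n + i) / 2))
    (halts_of_loopFree rfl (by decide) (by simp_all [Cmd.run, NExp.eval])) ?_ (by omega)
  rintro _ - rfl
  refine (halts_loop (T := 43) (T₁ := b * 47 + 4) (fun k s' => s'.nv vnode < 2 ^ k ∧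
      s'.nv vnode < n ∧
      (∀ i < n, s'.na atree (n + i) = i) ∧
      (∀ v, 0 < v → v < 2 * n → WinnerBelow n (s'.na atree) v) ∧
      (∀ v, 0 < v → v < n → (∃ k, v = s'.nv vnode / 2 ^ k) ∨
        WinsAt (s.ra akey) (s'.na atree) v)) ?_ b ?_ ?_).mono le_rfl ?_
  · rintro k s₁ f₁ ⟨hk, hkn, hl, hb, hw⟩ hlt
    have hlt : 0 < s₁.nv vnode := by simpa [BExp.Holds, NExp.eval] using hlt
    cases k with
    | zero => simp at hk; simp at hlt; omega
    | succ k =>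
    refine ⟨k, rfl, ?_⟩
    refine Halts.seq (T₁ := 40) (T₂ := 3) (halts_pull hlt) ?_ le_rfl
    rintro s₂ f₂ ⟨c, hc, he, hwk⟩
    have hkey : s₁.ra akey = s.ra akey := f₁.ra akey rfl
    have hnode : s₂.nv vnode = s₁.nv vnode := f₂.nv vnode rfl
    generalize s₁.nv vnode = u at *
    rw [hkey, he] at hwk
    refine halts_of_loopFree rfl (by decide) ?_
    have hr : Cmd.run F (.setN vnode (.half (.var vnode))) s₂ = s₂.setN vnode (u / 2) := by
      simp_all [Cmd.run, NExp.eval]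
    have hv : (s₂.setN vnode (u / 2)).nv vnode = u / 2 := by simp
    rw [hr, Store.na_setN, he, hv]
    refine ⟨by rw [pow_succ] at hk; omega, by omega, fun i hi => ?_, fun v hv hvn => ?_,
      fun v hv hvn => ?_⟩
    · rw [Function.update_of_ne (by omega)]
      exact hl i hi
    · exact (hb c (by omega) (by omega)).update hc fun h => hb v hv hvn
    · by_cases hvu : v = u
      · right; rw [hvu]; exact hwk
      · by_cases hvu' : v = u / 2
        · exact .inl ⟨0, by simpa using hvu'⟩
        · rcases hw v hv hvn with ⟨k', hk'⟩ | hw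
          · left
            cases k' with
            | zero => simp at hk'; omega
            | succ k' => exact ⟨k', by rw [Nat.div_div_eq_div_mul, ← pow_succ']; exact hk'⟩
          · exact .inr (hw.update hvu hvu')
  · have hv : (s.setN vnode ((n + i) / 2)).nv vnode = (n + i) / 2 := by simp
    rw [Store.na_setN, hv]
    refine ⟨by omega, by omega, h.leaf, h.below, fun v hv hvn => ?_⟩
    by_cases hanc : ∃ k, v = (n + i) / 2 / 2 ^ k
    · exact .inl hanc
    · right
      -- If a child of `v` were won by `i`, then `v` would be an ancestor of the leaf of `i`. So the
      -- three keys compared at `v` are unchanged.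
      have hne : ∀ u, 0 < u → u < 2 * n → v = u / 2 → s.na atree u ≠ i := by
        intro u hu hun hvu heq
        obtain ⟨-, k, hk⟩ := h.below u hu hun
        rw [heq] at hk
        refine hanc ⟨k, ?_⟩
        rw [hvu, hk, Nat.div_div_eq_div_mul, Nat.div_div_eq_div_mul, mul_comm]
      have hnv : s.na atree v ≠ i := by
        intro heq
        obtain ⟨-, k, hk⟩ := h.below v hv (by omega)
        rw [heq] at hk
        cases k with
        | zero => simp at hk; omega
        | succ k => exact hanc ⟨k, by rw [Nat.div_div_eq_div_mul, ← pow_succ']; exact hk⟩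
      have := h.wins v hv hvn
      unfold WinsAt at *
      rwa [hkey _ hnv, hkey _ (hne (2 * v) (by omega) (by omega) (by omega)),
        hkey _ (hne (2 * v + 1) (by omega) (by omega) (by omega))]
  · simp only [BExp.cost, NExp.cost]; omega
  · rintro s' - ⟨⟨k, -, -, hl, hb, hw⟩, hlt⟩
    have h0 : s'.nv vnode = 0 := by simpa [BExp.Holds, NExp.eval] using hlt
    refine ⟨hl, hb, fun v hv hvn => (hw v hv hvn).resolve_left ?_⟩
    rintro ⟨k, hk⟩
    rw [h0, Nat.zero_div] at hk
    omega

/-! The phases -/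

/-- The utility functions given by the oracle, extended by constants above `C`. -/
def capOracle (F : ℕ → ℕ → ℝ) (C i k : ℕ) : ℝ := F i (min k C)

/-- The machine has no minimum; with truncated subtraction `a - (a - C) = min a C`. -/
theorem gain_capOracle (F : ℕ → ℕ → ℝ) (C i k : ℕ) :
    gain (capOracle F C) i k = F i (k + 1 - (k + 1 - C)) - F i (k - (k - C)) := by
  unfold gain capOracle
  rw [show k + 1 - (k + 1 - C) = min (k + 1) C by omega, show k - (k - C) = min k C by omega]

theorem run_updateKey (s : Store) : updateKey.run F s =
    s.putR akey (s.nv vi) (gain (capOracle F (s.nv vC)) (s.nv vi) (s.na ahat (s.nv vi))) := by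
  simp [updateKey, Cmd.run, RExp.eval, NExp.eval, capExp, gain_capOracle]

theorem halts_startPhase {n C : ℕ} (hn : s.nv vn = n) (hC : s.nv vC = C) :
    Halts F startPhase s (n * 48 + 6) (fun s' => ∀ i < n, s'.na alow i = s.na ahat i ∧
      s'.ra akey i = gain (capOracle F C) i (s.na ahat i) ∧ s'.na atree (n + i) = i) := by
  refine halts_forLoop (T := 40) n (fun k s' => ∀ i < k, s'.na alow i = s.na ahat i ∧
      s'.ra akey i = gain (capOracle F C) i (s.na ahat i) ∧ s'.na atree (n + i) = i)
      hn rfl rfl (by simp) (by simp) ?_ le_rfl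
  intro k hk s₁ f₁ hk₁ hn₁ hI
  have hC₁ : s₁.nv vC = C := (f₁.nv vC rfl).trans hC
  have hx₁ : s₁.na ahat = s.na ahat := f₁.na ahat rfl
  refine halts_of_loopFree rfl (by decide) fun i hi => ?_
  simp only [Cmd.run, run_updateKey, NExp.eval]
  by_cases h : i = k
  · subst h; simp_all
  · obtain ⟨h1, h2, h3⟩ := hI i (by omega)
    simp_all

theorem sum_update_add {n : ℕ} (x : ℕ → ℕ) {i : ℕ} (hi : i < n) (v : ℕ) :
    ∑ k ∈ range n, Function.update x i v k + x i = ∑ k ∈ range n, x k + v := by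
  have := sum_range_update (fun _ k => (k : ℤ)) x hi v
  zify
  linarith

/-- The invariant of the greedy algorithm with step `d` started from `l`. -/
structure GreedyState (G : ℕ → ℕ → ℝ) (n B d : ℕ) (l : ℕ → ℕ) (s : Store) : Prop where
  sum : ∑ i ∈ range n, s.na ahat i + s.nv vfree = B
  key : ∀ i < n, s.ra akey i = gain G i (s.na ahat i)
  tree : IsTournament n (s.ra akey) (s.na atree)
  inv : GreedyInv G n d l (s.na ahat)

theorem halts_greedyStep {n b C B d : ℕ} {l : ℕ → ℕ}
    (hG : ∀ i < n, Antitone (gain (capOracle F C) i)) (hn0 : 0 < n) (hn : s.nv vn = n)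
    (hC : s.nv vC = C) (hb : n ≤ 2 ^ b) (hd : s.nv vstep = d) (hle : d ≤ s.nv vfree)
    (h : GreedyState (capOracle F C) n B d l s) :
    Halts F greedyStep s (b * 47 + 50) (fun s' => GreedyState (capOracle F C) n B d l s' ∧
      s'.nv vfree = s.nv vfree - d) := by
  have hroot := h.tree.key_le (i := s.na atree 1)
  have hi : s.na atree 1 < n := (h.tree.below 1 (by omega) (by omega)).1
  have hmax : ∀ j < n, gain (capOracle F C) j (s.na ahat j) ≤
      gain (capOracle F C) (s.na atree 1) (s.na ahat (s.na atree 1)) := fun j hj => by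
    rw [← h.key j hj, ← h.key _ hi]; exact h.tree.key_le hj
  generalize hi' : s.na atree 1 = i at *
  have key : Halts F (.setN vi (.cell atree (.lit 1)) ;;
      .putN ahat (.var vi) (.add (.cell ahat (.var vi)) (.var vstep)) ;;
      .setN vfree (.sub (.var vfree) (.var vstep)) ;; updateKey) s 40 (fun s' => s'.nv vi = i ∧
        s'.na ahat = Function.update (s.na ahat) i (s.na ahat i + d) ∧
        s'.nv vfree = s.nv vfree - d ∧
        s'.ra akey = Function.update (s.ra akey) i
          (gain (capOracle F C) i (s.na ahat i + d))) := by
    refine halts_of_loopFree rfl (by decide) ?_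
    simp only [Cmd.run, run_updateKey, NExp.eval]
    simp_all
  obtain ⟨s₁, t₁, e₁, ht₁, h1, h2, h3, h4⟩ := key
  have f₁ := e₁.frame
  have htree : s₁.na atree = s.na atree := f₁.na atree rfl
  obtain ⟨s₂, t₂, e₂, ht₂, hT⟩ := halts_updateTree (F := F) (s := s₁) (key := s.ra akey)
    ((f₁.nv vn rfl).trans hn) (by omega) hb (htree ▸ h.tree) (fun j hj => by
      rw [h4, Function.update_of_ne (by omega)])
  have f₂ := e₂.frame
  have hx₂ : s₂.na ahat = s₁.na ahat := f₂.na ahat rfl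
  have hk₂ : s₂.ra akey = s₁.ra akey := f₂.ra akey rfl
  have hv₂ : s₂.nv vfree = s₁.nv vfree := f₂.nv vfree rfl
  -- The first four commands were run as one block; this reassociates them with `updateTree`.
  have hexec : ∃ t ≤ t₁ + t₂, Exec F greedyStep s s₂ t := by
    cases e₁ with
    | seq a1 a2 =>
    cases a2 with
    | seq a2 a3 =>
    cases a3 with
    | seq a3 a4 => exact ⟨_, by omega, .seq a1 (.seq a2 (.seq a3 (.seq a4 e₂)))⟩
  obtain ⟨t, ht, e⟩ := hexec
  refine ⟨s₂, t, e, by omega, ⟨?_, ?_, ?_, ?_⟩, by rw [hv₂, h3]⟩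
  · have := sum_update_add (s.na ahat) hi (s.na ahat i + d)
    have := h.sum
    rw [hx₂, h2, hv₂, h3]
    omega
  · intro j hj
    rw [hk₂, h4, hx₂, h2]
    by_cases hji : j = i
    · subst hji; simp
    · rw [Function.update_of_ne hji, Function.update_of_ne hji]
      exact h.key j hj
  · rw [hk₂]; exact hT
  · rw [hx₂, h2]
    exact h.inv.step hG hi hmax

theorem halts_greedyLoop {n b C B d : ℕ} {l : ℕ → ℕ}
    (hG : ∀ i < n, Antitone (gain (capOracle F C) i)) (hn0 : 0 < n) (hn : s.nv vn = n)
    (hC : s.nv vC = C) (hb : n ≤ 2 ^ b) (hd : s.nv vstep = d)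
    (k : ℕ) (hle : s.nv vfree < (k + 1) * d) (h : GreedyState (capOracle F C) n B d l s) :
    Halts F (.loop (.not (.nlt (.var vfree) (.var vstep))) greedyStep) s (k * (b * 47 + 55) + 5)
      (fun s' => GreedyState (capOracle F C) n B d l s' ∧ s'.nv vfree < d) := by
  refine (halts_loop (T := b * 47 + 50) (T₁ := k * (b * 47 + 55) + 5) (fun k s' =>
    s'.nv vfree < (k + 1) * d ∧ GreedyState (capOracle F C) n B d l s') ?_ k ⟨hle, h⟩ ?_).mono
    le_rfl ?_
  · rintro k s₁ f₁ ⟨hk, h₁⟩ hlt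
    have hd₁ : s₁.nv vstep = d := (f₁.nv vstep rfl).trans hd
    have hlt : d ≤ s₁.nv vfree := by
      simp [BExp.Holds, NExp.eval] at hlt hd₁ ⊢; omega
    cases k with
    | zero => omega
    | succ k =>
    refine ⟨k, rfl, (halts_greedyStep hG hn0 ((f₁.nv vn rfl).trans hn) ((f₁.nv vC rfl).trans hC) hb
      hd₁ hlt h₁).mono le_rfl ?_⟩
    rintro s₂ - ⟨h₂, hv⟩
    refine ⟨?_, h₂⟩
    rw [hv]
    rw [show (k + 1 + 1) * d = (k + 1) * d + d by ring] at hk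
    omega
  · simp only [BExp.cost, NExp.cost]
    exact (by ring : _ = _).le
  · rintro s₂ f₂ ⟨⟨k, -, h₂⟩, hlt⟩
    refine ⟨h₂, ?_⟩
    have hd₂ : s₂.nv vstep = d := (f₂.nv vstep rfl).trans hd
    simp [BExp.Holds, NExp.eval] at hlt hd₂ ⊢; omega

/-- The greedy loop leaves at most `d - 1` units free, and each of the `n` threads returns at most
`d - 1` more. `hlx` ensures that truncated subtraction takes away exactly what is returned. -/
theorem halts_endPhase {n B d : ℕ} {l x : ℕ → ℕ} (hn : s.nv vn = n) (hd : s.nv vstep = d)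
    (hl : ∀ i < n, s.na alow i = l i) (hx : s.na ahat = x) (hfree : s.nv vfree < d)
    (hsum : ∑ i ∈ range n, x i + s.nv vfree = B) (hlx : ∀ i < n, l i < x i → d ≤ x i) :
    Halts F endPhase s (n * 40 + 6) (fun s' => ∑ i ∈ range n, s'.na ahat i + s'.nv vfree = B ∧
      s'.nv vfree ≤ (d - 1) * (n + 1) ∧
      ∀ i < n, s'.na ahat i = if l i < x i then x i - (d - 1) else x i) := by
  refine (halts_forLoop (T := 32) n (fun k s' => ∑ i ∈ range n, s'.na ahat i + s'.nv vfree = B ∧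
      s'.nv vfree ≤ (d - 1) * (k + 1) ∧
      (∀ i < k, s'.na ahat i = if l i < x i then x i - (d - 1) else x i) ∧
      ∀ i, k ≤ i → s'.na ahat i = x i)
      hn rfl rfl (by simp) ?_ ?_ (by omega)).mono le_rfl ?_
  · refine ⟨?_, ?_, by simp, by simpa using fun i => congrFun hx i⟩
    · rw [Store.na_setN, hx]; simpa using hsum
    · have : (s.setN vi 0).nv vfree = s.nv vfree := by simp
      rw [this]; omega
  · rintro k hk s₁ f₁ hk₁ - ⟨h1, h2, h3, h4⟩
    have hl₁ : s₁.na alow k = l k := by rw [f₁.na alow rfl]; exact hl k hk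
    have hd₁ : s₁.nv vstep = d := (f₁.nv vstep rfl).trans hd
    have hx₁ := h4 k le_rfl
    have hm : (d - 1) * (k + 1 + 1) = (d - 1) * (k + 1) + (d - 1) := by ring
    refine halts_ite (T := 20) (fun h => ?_) (fun h => ?_) (by decide)
    · have h : l k < x k := by
        simp only [BExp.Holds, NExp.eval, hk₁, hl₁, hx₁] at h; exact h
      refine halts_of_loopFree rfl (by decide) ?_
      set s₂ := Cmd.run F (.setN vfree (.add (.var vfree) (.sub (.var vstep) (.lit 1))) ;;
        .putN ahat (.var vi) (.sub (.cell ahat (.var vi)) (.sub (.var vstep) (.lit 1)))) s₁ with hs₂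
      have e1 : (s₂.setN vi (k + 1)).nv vfree = s₁.nv vfree + (d - 1) := by
        rw [hs₂]; simp_all [Cmd.run, NExp.eval]
      have e2 : (s₂.setN vi (k + 1)).na ahat =
          Function.update (s₁.na ahat) k (x k - (d - 1)) := by
        rw [hs₂]; simp_all [Cmd.run, NExp.eval]
      rw [e1, e2]
      have := sum_update_add (s₁.na ahat) hk (x k - (d - 1))
      have := hlx k hk h
      refine ⟨by omega, by omega, fun i hi => ?_, fun i hi => ?_⟩
      · by_cases hik : i = k
        · subst hik; rw [Function.update_self, if_pos h]
        · rw [Function.update_of_ne hik]; exact h3 i (by omega)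
      · rw [Function.update_of_ne (by omega)]; exact h4 i (by omega)
    · have h : ¬ l k < x k := by
        simp only [BExp.Holds, NExp.eval, hk₁, hl₁, hx₁] at h; exact h
      refine halts_of_loopFree rfl (by decide) ?_
      have e1 : ((Cmd.skip.run F s₁).setN vi (k + 1)).nv vfree = s₁.nv vfree := by
        simp [Cmd.run]
      have e2 : ((Cmd.skip.run F s₁).setN vi (k + 1)).na ahat = s₁.na ahat := by
        simp [Cmd.run]
      rw [e1, e2]
      refine ⟨h1, by omega, fun i hi => ?_, fun i hi => h4 i (by omega)⟩
      by_cases hik : i = k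
      · subst hik; rw [if_neg h]; exact hx₁
      · exact h3 i (by omega)
  · rintro s' - ⟨h1, h2, h3, -⟩
    exact ⟨h1, h2, h3⟩

/-- Between the phases: the resource is divided between the threads and a reserve of size at most
`D`, and some optimal vector gives every thread at least as much. -/
structure PhaseState (G : ℕ → ℕ → ℝ) (n B D : ℕ) (s : Store) : Prop where
  sum : ∑ i ∈ range n, s.na ahat i + s.nv vfree = B
  free : s.nv vfree ≤ D
  opt : ∃ z, IsOptimal G n B z ∧ ∀ i < n, s.na ahat i ≤ z i

/-- A reserve of at most `2 * d * (n + 1)` allows at most `2 * (n + 1)` steps of size `d`, each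
costing `O(b)`. -/
theorem halts_phase {n b C B d : ℕ} (hG : ∀ i < n, Antitone (gain (capOracle F C) i))
    (hn0 : 0 < n) (hn : s.nv vn = n) (hC : s.nv vC = C) (hb : n ≤ 2 ^ b) (hb0 : 0 < b)
    (hd : s.nv vstep = d) (hd0 : 0 < d)
    (h : PhaseState (capOracle F C) n B (2 * d * (n + 1)) s) :
    Halts F phase s (1000 * (n * b)) (PhaseState (capOracle F C) n B ((d - 1) * (n + 1))) := by
  have hnb : n ≤ n * b := Nat.le_mul_of_pos_right _ hb0
  have hbn : b ≤ n * b := Nat.le_mul_of_pos_left _ hn0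
  refine Halts.seq (T₂ := 1000 * (n * b) - (n * 48 + 6)) (halts_startPhase hn hC) ?_ (by omega)
  intro s₁ f₁ h₁
  have hx₁ : s₁.na ahat = s.na ahat := f₁.na ahat rfl
  refine Halts.seq (T₂ := 1000 * (n * b) - (n * 48 + 6) - (n * 48 + 8))
    (halts_buildTree (n := n) ((f₁.nv vn rfl).trans hn) hn0 fun i hi => (h₁ i hi).2.2) ?_
    (by omega)
  intro s₂ f₂ h₂
  have hx₂ : s₂.na ahat = s.na ahat := (f₂.na ahat rfl).trans hx₁
  have hk₂ : s₂.ra akey = s₁.ra akey := f₂.ra akey rfl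
  have hl₂ : s₂.na alow = s₁.na alow := f₂.na alow rfl
  have hn₂ : s₂.nv vn = n := (f₂.nv vn rfl).trans ((f₁.nv vn rfl).trans hn)
  have hC₂ : s₂.nv vC = C := (f₂.nv vC rfl).trans ((f₁.nv vC rfl).trans hC)
  have hd₂ : s₂.nv vstep = d := (f₂.nv vstep rfl).trans ((f₁.nv vstep rfl).trans hd)
  have hv₂ : s₂.nv vfree = s.nv vfree := (f₂.nv vfree rfl).trans (f₁.nv vfree rfl)
  have hg₂ : GreedyState (capOracle F C) n B d (s.na ahat) s₂ := by
    refine ⟨by rw [hx₂, hv₂]; exact h.sum, fun i hi => ?_, by rw [hk₂]; exact h₂, ?_⟩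
    · rw [hk₂, hx₂]; exact (h₁ i hi).2.1
    · rw [hx₂]; exact fun i _ => .inl rfl
  have hk : s₂.nv vfree < (2 * (n + 1) + 1) * d := by
    have h' := h.free
    have : (2 * (n + 1) + 1) * d = 2 * d * (n + 1) + d := by ring
    rw [hv₂]; omega
  refine Halts.seq (T₂ := n * 40 + 6)
    (halts_greedyLoop hG hn0 hn₂ hC₂ hb hd₂ (2 * (n + 1)) hk hg₂) ?_ ?_
  · rintro s₃ f₃ ⟨hg₃, hv₃⟩
    have hl₃ : s₃.na alow = s₁.na alow := (f₃.na alow rfl).trans hl₂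
    refine (halts_endPhase (n := n) (B := B) (d := d) (l := s.na ahat) (x := s₃.na ahat)
      ((f₃.nv vn rfl).trans hn₂) ((f₃.nv vstep rfl).trans hd₂)
      (fun i hi => by rw [hl₃]; exact (h₁ i hi).1) rfl hv₃ hg₃.sum (fun i hi hlt => ?_)).mono
      le_rfl ?_
    · rcases hg₃.inv i hi with h | h <;> omega
    · rintro s₄ - ⟨e1, e2, e3⟩
      refine ⟨e1, e2, ?_⟩
      obtain ⟨z, hz, hle⟩ := hg₃.inv.exists_isOptimal hG hd0 (by have := hg₃.sum; omega) h.opt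
      exact ⟨z, hz, fun i hi => by rw [e3 i hi]; exact hle i hi⟩
  · have : 2 * (n + 1) * (b * 47 + 55) = 94 * (n * b) + 110 * n + 94 * b + 110 := by ring
    omega

/-! ### Halving the step down to one unit -/

theorem halts_superOptAlgorithm {n m b C P : ℕ}
    (hG : ∀ i < n, Antitone (gain (capOracle F C) i)) (hn0 : 0 < n) (hn : s.nv vn = n)
    (hm : s.nv vm = m) (hC : s.nv vC = C) (hfree : s.nv vfree = 0) (hx : s.na ahat = fun _ => 0)
    (hb : n ≤ 2 ^ b) (hb0 : 0 < b) (hP : m * C < 2 ^ P) :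
    Halts F superOptAlgorithm s (2000 * (n * b * (P + 1)) + 12 * m) (fun s' =>
      ∃ x, IsOptimal (capOracle F C) n (m * C) x ∧ ∀ i < n, s'.na ahat i = min (x i) C) := by
  have hnb : n ≤ n * b := Nat.le_mul_of_pos_right _ hb0
  have hnbP : n * b * (P + 1) = n * b * P + n * b := by ring
  have hP' : P ≤ n * b * P := Nat.le_mul_of_pos_left _ (by omega)
  refine Halts.seq (T₁ := m * (4 + 8) + 6) (T₂ := 2000 * (n * b * (P + 1)) - 6)
    (halts_forLoop (T := 4) m (fun k s' => s'.nv vfree = k * C) hm rfl rfl (by simp) (by simpa)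
      ?_ le_rfl) ?_ (by omega)
  · intro k hk s₁ f₁ hk₁ _ hI
    have : s₁.nv vC = C := (f₁.nv vC rfl).trans hC
    refine halts_of_loopFree rfl (by decide) ?_
    simp_all [Cmd.run, NExp.eval, add_mul]
  intro s₁ f₁ hfree₁
  have hx₁ : s₁.na ahat = fun _ => 0 := (f₁.na ahat rfl).trans hx
  have hn₁ : s₁.nv vn = n := (f₁.nv vn rfl).trans hn
  have hC₁ : s₁.nv vC = C := (f₁.nv vC rfl).trans hC
  refine Halts.seq (T₁ := 2) (T₂ := 2000 * (n * b * (P + 1)) - 8)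
    (P := fun s' => s' = s₁.setN vstep 1) (halts_of_loopFree rfl (by decide) rfl) ?_ (by omega)
  rintro _ - rfl
  refine Halts.seq (T₁ := P * 9 + 5) (T₂ := 2000 * (n * b * (P + 1)) - 13 - P * 9)
    (P := fun s' => ∃ p ≤ P, s'.nv vstep = 2 ^ p ∧ m * C < 2 ^ p) ((halts_loop (T := 4)
      (fun k s' => ∃ p, s'.nv vstep = 2 ^ p ∧ p + k = P) ?_ P ⟨0, by simp, by simp⟩ ?_).mono
      le_rfl ?_) ?_ (by omega)
  · rintro k s₂ f₂ ⟨p, hp, hpk⟩ hlt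
    have hfree₂ : s₂.nv vfree = m * C := (f₂.nv vfree rfl).trans (by simpa using hfree₁)
    have hlt : 2 ^ p ≤ m * C := by
      simp only [BExp.Holds, NExp.eval] at hlt; omega
    have hpP : p < P := (Nat.pow_lt_pow_iff_right (by norm_num)).1 (hlt.trans_lt hP)
    refine ⟨k - 1, by omega, halts_of_loopFree rfl (by decide) ⟨p + 1, ?_, by omega⟩⟩
    simp only [Cmd.run, NExp.eval, Store.nv_setN, if_true, hp]
    ring
  · simp only [BExp.cost, NExp.cost]; omega
  · rintro s₂ f₂ ⟨⟨k, p, hp, hpk⟩, hlt⟩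
    have hfree₂ : s₂.nv vfree = m * C := (f₂.nv vfree rfl).trans (by simpa using hfree₁)
    refine ⟨p, by omega, hp, ?_⟩
    simp only [BExp.Holds, NExp.eval] at hlt; omega
  rintro s₂ f₂ ⟨p, hpP, hp, hlt⟩
  have hfree₂ : s₂.nv vfree = m * C := (f₂.nv vfree rfl).trans (by simpa using hfree₁)
  have hx₂ : s₂.na ahat = fun _ => 0 := (f₂.na ahat rfl).trans hx₁
  have hn₂ : s₂.nv vn = n := (f₂.nv vn rfl).trans (by simpa using hn₁)
  have hC₂ : s₂.nv vC = C := (f₂.nv vC rfl).trans (by simpa using hC₁)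
  refine Halts.seq (T₁ := (P + 1) * (1000 * (n * b) + 7) + 4) (T₂ := n * 20 + 6)
    -- The index `k` counts the remaining phases: `p + 1` while the step is `2 ^ p`, and 0 once step
    -- 1 has been halved to 0.
    (P := fun s' => IsOptimal (capOracle F C) n (m * C) (s'.na ahat)) ((halts_loop
      (T := 1000 * (n * b) + 3)
      (fun k s' => (k = 0 ∧ s'.nv vstep = 0 ∧ PhaseState (capOracle F C) n (m * C) 0 s') ∨
        ∃ p, k = p + 1 ∧ s'.nv vstep = 2 ^ p ∧
          PhaseState (capOracle F C) n (m * C) (2 * 2 ^ p * (n + 1)) s') ?_ (p + 1) ?_ ?_).mono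
      le_rfl ?_) ?_ ?_
  · rintro k s₃ f₃ hk hpos
    have hpos : 0 < s₃.nv vstep := hpos
    obtain ⟨-, h0, -⟩ | ⟨q, rfl, hq, hst⟩ := hk
    · omega
    refine ⟨q, rfl, ?_⟩
    refine Halts.seq (T₂ := 3) (halts_phase hG hn0 ((f₃.nv vn rfl).trans hn₂)
      ((f₃.nv vC rfl).trans hC₂) hb hb0 hq (by positivity) hst) ?_ le_rfl
    intro s₄ f₄ h₄
    have hq₄ : s₄.nv vstep = 2 ^ q := (f₄.nv vstep rfl).trans hq
    refine halts_of_loopFree rfl (by decide) ?_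
    have hr : Cmd.run F (.setN vstep (.half (.var vstep))) s₄ = s₄.setN vstep (2 ^ q / 2) := by
      simp_all [Cmd.run, NExp.eval]
    rw [hr]
    have hfr : (s₄.setN vstep (2 ^ q / 2)).nv vfree = s₄.nv vfree := by simp
    cases q with
    | zero =>
      left
      refine ⟨rfl, by simp, ⟨?_, ?_, ?_⟩⟩
      · rw [hfr]; exact h₄.sum
      · rw [hfr]; simpa using h₄.free
      · exact h₄.opt
    | succ q =>
      right
      refine ⟨q, rfl, by simp [pow_succ], ⟨?_, ?_, ?_⟩⟩
      · rw [hfr]; exact h₄.sum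
      -- The reserve left by step `2 ^ (q + 1)` fits the next phase because `2 ^ (q + 1) - 1 ≤ 2 * 2
      -- ^ q`.
      · rw [hfr]
        refine h₄.free.trans (Nat.mul_le_mul_right _ ?_)
        rw [pow_succ]; omega
      · exact h₄.opt
  · right
    obtain ⟨z, hz⟩ := exists_isOptimal (capOracle F C) hn0 (m * C)
    refine ⟨p, rfl, hp, ⟨?_, ?_, z, hz, fun i _ => ?_⟩⟩
    · rw [hx₂, hfree₂]; simp
    · rw [hfree₂]
      nlinarith [Nat.zero_le (2 ^ p * n)]
    · rw [hx₂]; simp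
  · simp only [BExp.cost, NExp.cost]
    have := Nat.mul_le_mul_right (1 + 1 + 1 + 1 + (1000 * (n * b) + 3)) (Nat.succ_le_succ hpP)
    refine (Nat.add_le_add_right (Nat.add_le_add_right this _) _).trans (le_of_eq ?_)
    simp only [Nat.succ_eq_add_one]; ring
  · rintro s₃ f₃ ⟨⟨k, hk⟩, hpos⟩
    have hpos : ¬ 0 < s₃.nv vstep := hpos
    obtain ⟨-, -, hst⟩ | ⟨q, rfl, hq, -⟩ := hk
    -- After step 1 the reserve is at most `(1 - 1) * (n + 1) = 0`, so the vector has full sum.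
    · refine isOptimal_of_sum_eq ?_ hst.opt
      have h1 := hst.sum
      have h2 := hst.free
      omega
    · exact absurd (by rw [hq]; positivity) hpos
  · intro s₃ f₃ hopt
    have hn₃ : s₃.nv vn = n := (f₃.nv vn rfl).trans hn₂
    have hC₃ : s₃.nv vC = C := (f₃.nv vC rfl).trans hC₂
    refine (halts_forLoop (T := 12) n (fun k s' => (∀ i < k, s'.na ahat i = min (s₃.na ahat i) C) ∧
      ∀ i, k ≤ i → s'.na ahat i = s₃.na ahat i) hn₃ rfl rfl (by simp) ⟨by simp, by simp⟩ ?_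
      (by omega)).mono le_rfl fun s' _ h => ⟨_, hopt, h.1⟩
    rintro k hk s₄ f₄ hk₄ - ⟨h1, h2⟩
    have hC₄ : s₄.nv vC = C := (f₄.nv vC rfl).trans hC₃
    have hmin : ∀ a, a - (a - C) = min a C := fun a => by omega
    have hk' := h2 k le_rfl
    refine halts_of_loopFree rfl (by decide) ⟨fun i hi => ?_, fun i hi => ?_⟩
    · by_cases hik : i = k
      · subst hik; simp_all [Cmd.run, NExp.eval, capExp]
      · have := h1 i (by omega)
        simp_all [Cmd.run, NExp.eval, capExp]
    · have := h2 i (by omega)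
      have hik : i ≠ k := by omega
      simp_all [Cmd.run, NExp.eval, capExp]
  · have : (P + 1) * (1000 * (n * b) + 7) = 1000 * (n * b * P) + 1000 * (n * b) + 7 * P + 7 := by
      ring
    omega

end AA

end

noncomputable section

namespace AA

/-! ## The running time -/

theorem sq_log_two_le (n : ℕ) (hn : 0 < n) : (Nat.log 2 n) ^ 2 ≤ 4 * n := by
  -- The terms `2 * k + 3` let the induction close: doubling the left side at `k` dominates it at `k
  -- + 1`.
  have key : ∀ k : ℕ, k ^ 2 + 2 * k + 3 ≤ 4 * 2 ^ k := by
    intro k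
    induction k with
    | zero => norm_num
    | succ k ih => rw [pow_succ 2]; nlinarith
  have h1 := key (Nat.log 2 n)
  have h2 := Nat.pow_log_le_self 2 hn.ne'
  omega

theorem natLog_two_le_log {N : ℕ} (hN : 0 < N) : (Nat.log 2 N : ℝ) ≤ 2 * Real.log N := by
  have h1 : ((2 ^ Nat.log 2 N : ℕ) : ℝ) ≤ N := Nat.cast_le.2 (Nat.pow_log_le_self 2 hN.ne')
  have h2 := Real.log_le_log (by positivity) h1
  rw [Nat.cast_pow, Real.log_pow] at h2
  have h3 := Real.log_two_gt_d9
  have h4 : (0 : ℝ) ≤ Nat.log 2 N := Nat.cast_nonneg _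
  push_cast at h2
  nlinarith

theorem time_le {n m C t₁ t₂ : ℕ} (hn : 0 < n) (hm : 0 < m) (hC : 0 < C)
    (h₁ : t₁ ≤ 2000 * (n * (Nat.log 2 n + 1) * (Nat.log 2 (m * C) + 1 + 1)) + 12 * m)
    (h₂ : t₂ ≤ 400 * (n * n * m)) :
    ((t₁ + t₂ : ℕ) : ℝ) ≤ 40000 * (m * (n : ℝ) ^ 2 + n * (Real.log (m * C)) ^ 2) := by
  have hlog := natLog_two_le_log (Nat.mul_pos hm hC)
  have hsq : ((Nat.log 2 n : ℕ) : ℝ) ^ 2 ≤ 4 * n := by exact_mod_cast sq_log_two_le n hn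
  push_cast at hlog
  have h₁' : (t₁ : ℝ) ≤ 2000 * (n * ((Nat.log 2 n : ℕ) + 1) * ((Nat.log 2 (m * C) : ℕ) + 1 + 1))
      + 12 * m := by exact_mod_cast h₁
  have h₂' : (t₂ : ℝ) ≤ 400 * (n * n * m) := by exact_mod_cast h₂
  have ha : (0 : ℝ) ≤ (Nat.log 2 (m * C) : ℕ) := Nat.cast_nonneg _
  generalize ((Nat.log 2 n : ℕ) : ℝ) = β at *
  generalize ((Nat.log 2 (m * C) : ℕ) : ℝ) = a at *
  generalize Real.log (m * C) = L at *
  have hn1 : (1 : ℝ) ≤ n := by exact_mod_cast hn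
  have hm1 : (1 : ℝ) ≤ m := by exact_mod_cast hm
  push_cast
  -- The product of logarithms is split by the arithmetic-geometric mean inequality, using `β ^ 2 ≤
  -- 4 * n` and `a ≤ 2 * L`. The constants absorb small cases such as `L = 0`, since `n ≥ 1`.
  have hprod : (β + 1) * (a + 1 + 1) ≤ 18 * n + 8 * L ^ 2 := by
    have : a ^ 2 ≤ (2 * L) ^ 2 := pow_le_pow_left₀ ha hlog 2
    nlinarith [sq_nonneg (β - 1), sq_nonneg (a - 2), sq_nonneg (β + 1 - (a + 2))]
  have h3 := mul_le_mul_of_nonneg_left hprod (by linarith : (0 : ℝ) ≤ n)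
  have h4 : (n : ℝ) ^ 2 ≤ m * (n : ℝ) ^ 2 := le_mul_of_one_le_left (by positivity) hm1
  have h5 : (m : ℝ) ≤ m * (n : ℝ) ^ 2 := le_mul_of_one_le_right (by linarith) (one_le_pow₀ hn1)
  have h6 : 0 ≤ n * L ^ 2 := by positivity
  nlinarith

end AA

end

/-! ### Joining the two programs -/

theorem mainTheorem5 :
    ∃ (superOpt : AA.Cmd) (K : ℝ),
      ∀ (n m C : ℕ), 0 < n → 0 < m → 0 < C →
      ∀ A : AA.Problem n m, A.C = (C : ℝ) →
      ∃ (s₁ s₂ : AA.Store) (t₁ t₂ : ℕ) (chat c : Fin n → ℝ) (r : Fin n → Fin m),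
        -- the first phase computes a super-optimal allocation and keeps the input
        AA.Exec A.oracle superOpt (AA.inputStore n m C) s₁ t₁ ∧
        s₁.nv AA.vn = n ∧ s₁.nv AA.vm = m ∧ s₁.nv AA.vC = C ∧
        (∀ i : Fin n, chat i = (s₁.na AA.ahat i : ℝ)) ∧
        A.IsUnitSuperOptimal chat ∧
        (A.AffineBetweenUnits → A.IsSuperOptimal chat) ∧
        -- the second phase is the assignment algorithm
        AA.Exec A.oracle AA.assignAlgorithm s₁ s₂ t₂ ∧
        (∀ i : Fin n, ((r i : ℕ) = s₂.na AA.asrv i) ∧ c i = (s₂.na AA.aalloc i : ℝ)) ∧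
        A.IsOutput chat r c ∧
        -- the total running time
        ((t₁ + t₂ : ℕ) : ℝ) ≤ K * (m * (n : ℝ) ^ 2 + n * (Real.log (m * A.C)) ^ 2) := by
  refine ⟨AA.superOptAlgorithm, 40000, fun n m C hn hm hC A hAC => ?_⟩
  obtain ⟨s₁, t₁, e₁, ht₁, x, hx, hhat⟩ := AA.halts_superOptAlgorithm (F := A.oracle) (C := C)
    (s := AA.inputStore n m C) (b := Nat.log 2 n + 1) (P := Nat.log 2 (m * C) + 1)
    -- `A.capped C` and `capOracle A.oracle C` agree by definition, so the lemmas on capped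
    -- utilities apply to the program.
    (fun i hi => A.antitone_gain_capped hAC hi) hn rfl rfl rfl rfl rfl
    (Nat.lt_pow_succ_log_self (by norm_num) n).le (by omega)
    (Nat.lt_pow_succ_log_self (by norm_num) (m * C))
  have f₁ := e₁.frame
  have hn₁ : s₁.nv AA.vn = n := f₁.nv AA.vn rfl
  have hm₁ : s₁.nv AA.vm = m := f₁.nv AA.vm rfl
  have hC₁ : s₁.nv AA.vC = C := f₁.nv AA.vC rfl
  obtain ⟨s₂, t₂, e₂, ht₂, r, c, hrc, hout⟩ :=
    AA.halts_assignAlgorithm A hn hm hAC s₁ hn₁ hm₁ hC₁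
  have hchat : (fun i : Fin n => (s₁.na AA.ahat i : ℝ)) =
      fun i : Fin n => ((min (x i) C : ℕ) : ℝ) := by
    funext i
    rw [hhat i i.2]
  refine ⟨s₁, s₂, t₁, t₂, fun i => s₁.na AA.ahat i, c, r, e₁, hn₁, hm₁, hC₁, fun _ => rfl, ?_, ?_,
    e₂, hrc, hout, ?_⟩
  · rw [hchat]
    exact AA.Problem.isUnitSuperOptimal_truncate hAC hn hx
  · intro hA
    rw [hchat]
    exact AA.Problem.isSuperOptimal_truncate hAC hn hA hx
  · rw [hAC]
    exact AA.time_le hn hm hC ht₁ ht₂
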